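/- \textbf{Conventions.} We work with structures $M$ for the language of second-order arithmetic, with first-order part $\mathbb{N}$ (possibly nonstandard) and a nonempty collection of subsets of $\mathbb{N}$ over which set quantifiers range; all sets and functions below are those of the structure. A set is finite if it is bounded in $\mathbb{N}$ and infinite otherwise. $\mathsf{RCA}_0$ consists of the basic arithmetical axioms, the $\Sigma^0_1$ induction scheme and the $\Delta^0_1$ comprehension scheme; $\mathsf{ACA}_0$ consists of the basic axioms, the induction axiom for sets and the arithmetical comprehension scheme. A \emph{countable second-countable (CSC) space} is a triple $\langle X,\mathcal{U},k\rangle$, where $X\subseteq\mathbb{N}$; $\mathcal{U}=\langle U_n : n\in\mathbb{N}\rangle$ is a sequence of subsets of $X$ with every $x\in X$ in some $U_n$; and $k:X\times\mathbb{N}\times\mathbb{N}\to\mathbb{N}$ is a function such that $x\in U_m\cap U_n$ implies $x\in U_{k(x,m,n)}\subseteq U_m\cap U_n$. It is infinite if $X$ is. Its subspaces are the sets $Y\subseteq X$ with the basis $\langle U_n\cap Y : n\in\mathbb{N}\rangle$. The open sets are the unions $\bigcup_{n\in\operatorname{ran}(O)}U_n$ for functions $O:\mathbb{N}\to\mathbb{N}$,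 together with $\emptyset$. An infinite CSC space $\langle X,\mathcal{U},k\rangle$ \begin{itemize} \item is \emph{indiscrete} if $X$ is the only nonempty basic open set; \item has the \emph{initial segment topology} if there is a bijection $h:\mathbb{N}\to X$ such that every basic open set is $\emptyset$, $X$, or $\{h(i): i\le j\}$ for some $j$, and each set $\{h(i): i\le j\}$ is basic open; \item has the \emph{final segment topology} if there is a bijection $h:\mathbb{N}\to X$ such that every basic open set is $\emptyset$, $X$, or $\{h(i): i\ge j\}$ for some $j$, and each set $\{h(i): i\ge j\}$ is basic open; \item is \emph{discrete} if $\{x\}$ is basic open for every $x\in X$; \item has the \emph{cofinite topology} if every nonempty basic open set is cofinite in $X$ and every cofinite subset of $X$ is open; \item is \emph{$T_1$} if for all $x\ne y$ in $X$ there are basic open sets $U,V$ with $x\in U\setminus V$ and $y\in V\setminus U$. \end{itemize} $\mathsf{GS}$ is the statement that every infinite CSC space has an infinite subspace which is indiscrete, has the initial segment topology, has the final segment topology, is discrete, or has the cofinite topology. $\mathsf{wGS}$ is the statement that every infinite CSC space has an infinite subspace which is indiscrete, has the initial segment topology, has the final segment topology, or is $T_1$. \textbf{Theorem.} The following are equivalent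 over $\mathsf{RCA}_0$ (that is, in every model of $\mathsf{RCA}_0$): \begin{enumerate} \item $\mathsf{ACA}_0$; \item $\mathsf{GS}$; \item $\mathsf{wGS}$. \end{enumerate} -/

import Mathlib

universe u

namespace SOA

/-! ### The language of second-order arithmetic -/

/-- Number terms; number variables are indexed by natural numbers. -/
inductive Term : Type
  | var (i : ℕ) : Term
  | zero : Term
  | one : Term
  | add (s t : Term) : Term
  | mul (s t : Term) : Term

/-- The number variable `i` occurs in a term. -/
def Term.Occurs (i : ℕ) : Term → Prop
  | .var j => j = i
  | .zero => False
  | .one => False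
  | .add s t => s.Occurs i ∨ t.Occurs i
  | .mul s t => s.Occurs i ∨ t.Occurs i

/-- Formulas of second-order arithmetic, with number variables and set variables. -/
inductive Formula : Type
  | eq (s t : Term) : Formula
  | lt (s t : Term) : Formula
  | mem (s : Term) (X : ℕ) : Formula
  | not (φ : Formula) : Formula
  | and (φ ψ : Formula) : Formula
  | or (φ ψ : Formula) : Formula
  | imp (φ ψ : Formula) : Formula
  | all (i : ℕ) (φ : Formula) : Formula
  | ex (i : ℕ) (φ : Formula) : Formula
  | allSet (X : ℕ) (φ : Formula) : Formula
  | exSet (X : ℕ) (φ : Formula) : Formula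

/-- Bounded (`Σ⁰₀`) formulas: all quantifiers are of the form `∀ i < t` or `∃ i < t`, with `i` not
occurring in `t`. Set parameters are allowed. -/
inductive Formula.IsBounded : Formula → Prop
  | eq (s t : Term) : IsBounded (.eq s t)
  | lt (s t : Term) : IsBounded (.lt s t)
  | mem (s : Term) (X : ℕ) : IsBounded (.mem s X)
  | not {φ : Formula} : IsBounded φ → IsBounded (.not φ)
  | and {φ ψ : Formula} : IsBounded φ → IsBounded ψ → IsBounded (.and φ ψ)
  | or {φ ψ : Formula} : IsBounded φ → IsBounded ψ → IsBounded (.or φ ψ)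
  | imp {φ ψ : Formula} : IsBounded φ → IsBounded ψ → IsBounded (.imp φ ψ)
  | ball {i : ℕ} {t : Term} {φ : Formula} : ¬ t.Occurs i → IsBounded φ →
      IsBounded (.all i (.imp (.lt (.var i) t) φ))
  | bex {i : ℕ} {t : Term} {φ : Formula} : ¬ t.Occurs i → IsBounded φ →
      IsBounded (.ex i (.and (.lt (.var i) t) φ))

/-- `Σ⁰₁` formulas. -/
def Formula.IsSigma1 (φ : Formula) : Prop :=
  ∃ (i : ℕ) (θ : Formula), θ.IsBounded ∧ φ = .ex i θ

/-- `Π⁰₁` formulas. -/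
def Formula.IsPi1 (φ : Formula) : Prop :=
  ∃ (i : ℕ) (θ : Formula), θ.IsBounded ∧ φ = .all i θ

/-- Arithmetical formulas: no set quantifiers (set parameters are allowed). -/
def Formula.IsArithmetical : Formula → Prop
  | .eq _ _ => True
  | .lt _ _ => True
  | .mem _ _ => True
  | .not φ => φ.IsArithmetical
  | .and φ ψ => φ.IsArithmetical ∧ ψ.IsArithmetical
  | .or φ ψ => φ.IsArithmetical ∧ ψ.IsArithmetical
  | .imp φ ψ => φ.IsArithmetical ∧ ψ.IsArithmetical
  | .all _ φ => φ.IsArithmetical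
  | .ex _ φ => φ.IsArithmetical
  | .allSet _ _ => False
  | .exSet _ _ => False

/-! ### Structures and satisfaction -/

/-- A structure for the language of second-order arithmetic: a possibly nonstandard first-order part
`N` with `0, 1, +, ·, <`, and a nonempty collection of subsets of `N` over which set quantifiers
range. -/
structure L2Structure where
  N : Type u
  [zero : Zero N]
  [one : One N]
  [add : Add N]
  [mul : Mul N]
  [lt : LT N]
  sets : Set (Set N)
  sets_nonempty : sets.Nonempty

attribute [instance] L2Structure.zero L2Structure.one L2Structure.add L2Structure.mul L2Structure.lt

/-- The value of a term under an assignment of the number variables. -/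
def Term.val (M : L2Structure.{u}) (v : ℕ → M.N) : Term → M.N
  | .var i => v i
  | .zero => 0
  | .one => 1
  | .add s t => s.val M v + t.val M v
  | .mul s t => s.val M v * t.val M v

/-- Satisfaction of a formula under an assignment `v` of the number variables and an assignment `V`
of the set variables. -/
def Formula.Sat (M : L2Structure.{u}) : Formula → (ℕ → M.N) → (ℕ → M.sets) → Prop
  | .eq s t, v, _ => s.val M v = t.val M v
  | .lt s t, v, _ => s.val M v < t.val M v
  | .mem s X, v, V => s.val M v ∈ (V X : Set M.N)
  | .not φ, v, V => ¬ φ.Sat M v V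
  | .and φ ψ, v, V => φ.Sat M v V ∧ ψ.Sat M v V
  | .or φ ψ, v, V => φ.Sat M v V ∨ ψ.Sat M v V
  | .imp φ ψ, v, V => φ.Sat M v V → ψ.Sat M v V
  | .all i φ, v, V => ∀ a : M.N, φ.Sat M (Function.update v i a) V
  | .ex i φ, v, V => ∃ a : M.N, φ.Sat M (Function.update v i a) V
  | .allSet X φ, v, V => ∀ A : M.sets, φ.Sat M v (Function.update V X A)
  | .exSet X φ, v, V => ∃ A : M.sets, φ.Sat M v (Function.update V X A)

namespace L2Structure

variable (M : L2Structure.{u})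

/-- The basic first-order axioms of second-order arithmetic. -/
structure BasicAxioms : Prop where
  succ_ne_zero : ∀ n : M.N, n + 1 ≠ 0
  succ_inj : ∀ m n : M.N, m + 1 = n + 1 → m = n
  add_zero : ∀ m : M.N, m + 0 = m
  add_succ : ∀ m n : M.N, m + (n + 1) = (m + n) + 1
  mul_zero : ∀ m : M.N, m * 0 = 0
  mul_succ : ∀ m n : M.N, m * (n + 1) = m * n + m
  not_lt_zero : ∀ m : M.N, ¬ m < 0
  lt_succ_iff : ∀ m n : M.N, m < n + 1 ↔ m < n ∨ m = n

/-- The `Σ⁰₁` induction scheme (with number and set parameters). -/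
def Sigma1Induction : Prop :=
  ∀ φ : Formula, φ.IsSigma1 → ∀ (i : ℕ) (v : ℕ → M.N) (V : ℕ → M.sets),
    φ.Sat M (Function.update v i 0) V →
    (∀ a : M.N, φ.Sat M (Function.update v i a) V → φ.Sat M (Function.update v i (a + 1)) V) →
    ∀ a : M.N, φ.Sat M (Function.update v i a) V

/-- The `Δ⁰₁` comprehension scheme (with number and set parameters). -/
def Delta1Comprehension : Prop :=
  ∀ φ ψ : Formula, φ.IsSigma1 → ψ.IsPi1 → ∀ (i : ℕ) (v : ℕ → M.N) (V : ℕ → M.sets),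
    (∀ a : M.N, φ.Sat M (Function.update v i a) V ↔ ψ.Sat M (Function.update v i a) V) →
    {a : M.N | φ.Sat M (Function.update v i a) V} ∈ M.sets

/-- The induction axiom for the sets of the structure. -/
def SetInduction : Prop :=
  ∀ A ∈ M.sets, (0 : M.N) ∈ A → (∀ a ∈ A, a + 1 ∈ A) → ∀ a : M.N, a ∈ A

/-- The arithmetical comprehension scheme (with number and set parameters). -/
def ArithmeticalComprehension : Prop :=
  ∀ φ : Formula, φ.IsArithmetical → ∀ (i : ℕ) (v : ℕ → M.N) (V : ℕ → M.sets),
    {a : M.N | φ.Sat M (Function.update v i a) V} ∈ M.sets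

/-- `M` is a model of `RCA₀`. -/
structure IsModelRCA0 : Prop where
  basic : M.BasicAxioms
  induction : M.Sigma1Induction
  comprehension : M.Delta1Comprehension

/-- `M` is a model of `ACA₀`. -/
structure IsModelACA0 : Prop where
  basic : M.BasicAxioms
  induction : M.SetInduction
  comprehension : M.ArithmeticalComprehension

/-! ### Coding inside a structure

All quantifiers below range over the numbers `M.N` or over the sets in `M.sets`. -/

variable {M}

/-- The number coding an ordered pair: `(i + j)² + i`. -/
def pair (i j : M.N) : M.N := (i + j) * (i + j) + i

/-- `m ≤ n`. -/
def Le (m n : M.N) : Prop := m < n ∨ m = n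

/-- A set is finite in the sense of the structure if it has an upper bound in `M.N`. -/
def IsFin (A : Set M.N) : Prop := ∃ b : M.N, ∀ a ∈ A, a < b

/-- A set is infinite in the sense of the structure if it is unbounded in `M.N`. -/
def IsInf (A : Set M.N) : Prop := ¬ IsFin A

/-- The set `F` belongs to the structure and is (the graph of) a function from `A` to `B`. -/
structure IsFun (F A B : Set M.N) : Prop where
  mem : F ∈ M.sets
  sub : ∀ c ∈ F, ∃ a ∈ A, ∃ b ∈ B, c = pair a b
  total : ∀ a ∈ A, ∃! b, pair a b ∈ F

/-- The function with graph `F` is a bijection from `A` to `B`. -/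
structure IsBij (F A B : Set M.N) : Prop extends IsFun F A B where
  bij : ∀ b ∈ B, ∃! a, pair a b ∈ F

/-- The `n`-th member of the sequence of sets coded by `U`. -/
def sect (U : Set M.N) (n : M.N) : Set M.N := {x | pair x n ∈ U}

variable (M)

/-- The countable second-countable (CSC) spaces of the structure `M`. -/
structure CSCSpace where
  X : Set M.N
  X_mem : X ∈ M.sets
  /-- The code of the basis. -/
  U : Set M.N
  U_mem : U ∈ M.sets
  sub : ∀ n, sect U n ⊆ X
  cover : ∀ x ∈ X, ∃ n, x ∈ sect U n
  /-- The graph of a function `X × N × N → N`. -/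
  k : Set M.N
  k_fun : IsFun k {c | ∃ x ∈ X, ∃ m n, c = pair (pair x m) n} Set.univ
  k_spec : ∀ x ∈ X, ∀ m n r, pair (pair (pair x m) n) r ∈ k →
    x ∈ sect U m ∩ sect U n →
    x ∈ sect U r ∧ sect U r ⊆ sect U n ∩ sect U m

variable {M}

/-- The basis of a CSC space, as a family of sets. -/
def CSCSpace.basis (A : M.CSCSpace) : M.N → Set M.N := sect A.U

/-- The restriction `⟨B n ∩ Y : n ∈ N⟩` of a family of sets to `Y`. -/
def restrict (B : M.N → Set M.N) (Y : Set M.N) : M.N → Set M.N := fun n => B n ∩ Y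

/-! ### Topologies

`Y` is the underlying set and `B` the basis of a CSC space. The empty set and (in the
initial segment topology) the whole space are open but need not be members of a basis. -/

/-- Apart from possibly `∅`, the only basic open set is the whole space. -/
def Indiscrete (Y : Set M.N) (B : M.N → Set M.N) : Prop :=
  (∀ n, B n = ∅ ∨ B n = Y) ∧ ∃ n, B n = Y

/-- `{h(i) : i ≤ j}`, where `H` is the graph of `h`. -/
def initSeg (H : Set M.N) (j : M.N) : Set M.N := {x | ∃ i, Le i j ∧ pair i x ∈ H}

/-- `{h(i) : i ≥ j}`, where `H` is the graph of `h`. -/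
def finalSeg (H : Set M.N) (j : M.N) : Set M.N := {x | ∃ i, Le j i ∧ pair i x ∈ H}

/-- For some bijection `h : N → Y` of the structure, the basic open sets are, apart from possibly `∅`
and `Y`, precisely the sets `{h(i) : i ≤ j}`. -/
def InitialSegmentTopology (Y : Set M.N) (B : M.N → Set M.N) : Prop :=
  ∃ H : Set M.N, IsBij H Set.univ Y ∧
    (∀ n, B n = ∅ ∨ B n = Y ∨ ∃ j, B n = initSeg H j) ∧ ∀ j, ∃ n, B n = initSeg H j

/-- For some bijection `h : N → Y` of the structure, the basic open sets are, apart from possibly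
`∅`, precisely the sets `{h(i) : i ≥ j}` (for `j = 0` this is `Y`). -/
def FinalSegmentTopology (Y : Set M.N) (B : M.N → Set M.N) : Prop :=
  ∃ H : Set M.N, IsBij H Set.univ Y ∧
    (∀ n, B n = ∅ ∨ B n = Y ∨ ∃ j, B n = finalSeg H j) ∧ ∀ j, ∃ n, B n = finalSeg H j

/-- Every singleton is a basic open set. -/
def Discrete (Y : Set M.N) (B : M.N → Set M.N) : Prop :=
  ∀ x ∈ Y, ∃ n, B n = {x}

/-- The set of points of the open set coded by the function `N → N` with graph `O`: the union of
the `B n` over all `n` in the range of that function. -/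
def openSet (B : M.N → Set M.N) (O : Set M.N) : Set M.N :=
  {x | ∃ n, (∃ i, pair i n ∈ O) ∧ x ∈ B n}

/-- Every nonempty basic open set is cofinite in `Y`, and every cofinite subset of `Y` (in the
structure) is open, that is, has an open code. -/
def CofiniteTopology (Y : Set M.N) (B : M.N → Set M.N) : Prop :=
  (∀ n, B n = ∅ ∨ IsFin (Y \ B n)) ∧
    ∀ Z ∈ M.sets, Z ⊆ Y → IsFin (Y \ Z) →
      ∃ O : Set M.N, IsFun O Set.univ Set.univ ∧ openSet B O = Z

/-- The separation axiom `T₁`. -/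
def T1 (Y : Set M.N) (B : M.N → Set M.N) : Prop :=
  ∀ x ∈ Y, ∀ y ∈ Y, x ≠ y → ∃ m n, x ∈ B m \ B n ∧ y ∈ B n \ B m

variable (M)

/-- `M` satisfies `GS`: every infinite CSC space has an infinite subspace which is indiscrete, has
the initial segment topology, has the final segment topology, is discrete, or has the cofinite
topology. -/
def SatGS : Prop :=
  ∀ A : M.CSCSpace, IsInf A.X → ∃ Y ∈ M.sets, Y ⊆ A.X ∧ IsInf Y ∧
    (Indiscrete Y (restrict A.basis Y) ∨ InitialSegmentTopology Y (restrict A.basis Y) ∨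
      FinalSegmentTopology Y (restrict A.basis Y) ∨ Discrete Y (restrict A.basis Y) ∨
      CofiniteTopology Y (restrict A.basis Y))

/-- `M` satisfies `wGS`: every infinite CSC space has an infinite subspace which is indiscrete, has
the initial segment topology, has the final segment topology, or is `T₁`. -/
def SatWGS : Prop :=
  ∀ A : M.CSCSpace, IsInf A.X → ∃ Y ∈ M.sets, Y ⊆ A.X ∧ IsInf Y ∧
    (Indiscrete Y (restrict A.basis Y) ∨ InitialSegmentTopology Y (restrict A.basis Y) ∨
      FinalSegmentTopology Y (restrict A.basis Y) ∨ T1 Y (restrict A.basis Y))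

end L2Structure

end SOA

/-!
*`ACA₀` implies `GS`.* The preorder `x ∈ cl {y}`, which says that every basic open set containing
`x` contains `y`, is arithmetical. By two applications of Ramsey's theorem for pairs (`ramsey`)
there is an infinite set of points such that the answers to `x ∈ cl {y}` and to `y ∈ cl {x}` are the
same for all its elements `x < y`. The four cases yield an indiscrete subspace, the final segment
topology, the initial segment topology, and a `T₁` subspace. In the last case
(`CSCSpace.exists_discrete_or_cofinite`) basic open sets are discarded greedily, as long as each
meets what remains and leaves an infinite rest. If this stops, the rest has the cofinite topology;
if not, the least points of the discarded pieces form a discrete subspace. All greedy constructions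
are instances of course-of-values recursion (`exists_recursion`), for which finite sets of the
possibly nonstandard structure are coded by divisibility as in Gödel's `β`-function.

*`GS` implies `wGS`* because discrete and cofinite topologies are `T₁`.

*`wGS` implies `ACA₀`.* It suffices to show that the projection of every set `A` of the structure
belongs to the structure (`SatWGS.proj_mem`, `isModelACA0_of_proj_mem`). Enumerate the projection
without repetitions. A stage is true if it enumerates a number and no smaller number is enumerated
later. In the space `trueStageSpace`, the intersection of the neighbourhoods of `x` consists of `x`
and all points above some true stage `z ≥ x`, and each neighbourhood of `x` is contained in `{y | x
≤ y}`. Unless the enumeration stops, an infinite subspace can be neither indiscrete, nor of initial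
segment type, nor `T₁`. In a subspace with the final segment topology, enumerated by `h`, a true
stage separates `h i` from `h (i + 1)`; as the numbers enumerated at true stages increase, only
numbers `≥ i` are enumerated from stage `h i` on, which makes the projection `Δ⁰₁` in `h`.

Definability is handled semantically. `IsRel M P` and `IsMap M t` say that a relation or function on
tuples belongs to the structure; their closure properties are instances, so that instance resolution
proves the instances of comprehension and induction that are needed.
-/

namespace SOA.L2Structure

variable {M : L2Structure.{u}}

/-! ### Arithmetic in models of `RCA₀` -/

/-- Induction for predicates of the form `∃ b, θ(a, b)` with `θ` bounded; the variables `0` and `1`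
of `θ` stand for `a` and `b`, and the variables from `2` on for parameters. -/
theorem IsModelRCA0.sigma_induction (hM : M.IsModelRCA0) (θ : Formula) (hθ : θ.IsBounded)
    (v : ℕ → M.N) (P : M.N → Prop)
    (hP : ∀ V a, (∃ b, θ.Sat M (Function.update (Function.update v 0 a) 1 b) V) ↔ P a)
    (h0 : P 0) (hs : ∀ a, P a → P (a + 1)) (a : M.N) : P a := by
  obtain ⟨A, hA⟩ := M.sets_nonempty
  have := hM.induction (.ex 1 θ) ⟨1, θ, hθ, rfl⟩ 0 v fun _ => ⟨A, hA⟩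
  simp only [Formula.Sat, hP] at this
  exact this h0 hs a

namespace IsModelRCA0

variable (hM : M.IsModelRCA0)
include hM

theorem zero_add (m : M.N) : 0 + m = m := by
  refine hM.sigma_induction (.eq (.add .zero (.var 0)) (.var 0)) (.eq _ _) (fun _ => m)
    (fun a => 0 + a = a) (by simp [Formula.Sat, Term.val]) (hM.basic.add_zero _) ?_ m
  intro a h
  rw [hM.basic.add_succ, h]

theorem succ_add (m n : M.N) : m + 1 + n = m + n + 1 := by
  refine hM.sigma_induction (.eq (.add (.add (.var 2) .one) (.var 0))
    (.add (.add (.var 2) (.var 0)) .one)) (.eq _ _) (fun _ => m)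
    (fun a => m + 1 + a = m + a + 1) (by simp [Formula.Sat, Term.val]) ?_ ?_ n
  · simp only [hM.basic.add_zero]
  · intro a h
    rw [hM.basic.add_succ, h, hM.basic.add_succ]

theorem add_comm (m n : M.N) : m + n = n + m := by
  refine hM.sigma_induction (.eq (.add (.var 2) (.var 0)) (.add (.var 0) (.var 2))) (.eq _ _)
    (fun _ => m) (fun a => m + a = a + m) (by simp [Formula.Sat, Term.val]) ?_ ?_ n
  · rw [hM.basic.add_zero, hM.zero_add]
  · intro a h
    rw [hM.basic.add_succ, h, hM.succ_add]

theorem add_assoc (m n k : M.N) : m + n + k = m + (n + k) := by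
  refine hM.sigma_induction (.eq (.add (.add (.var 2) (.var 3)) (.var 0))
    (.add (.var 2) (.add (.var 3) (.var 0)))) (.eq _ _) (Function.update (fun _ => m) 3 n)
    (fun a => m + n + a = m + (n + a)) (by simp [Formula.Sat, Term.val]) ?_ ?_ k
  · simp only [hM.basic.add_zero]
  · intro a h
    simp only [hM.basic.add_succ, h]

theorem add_right_cancel (m n k : M.N) : m + k = n + k → m = n := by
  refine hM.sigma_induction (.imp (.eq (.add (.var 2) (.var 0)) (.add (.var 3) (.var 0)))
    (.eq (.var 2) (.var 3))) (.imp (.eq _ _) (.eq _ _)) (Function.update (fun _ => m) 3 n)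
    (fun a => m + a = n + a → m = n) (by simp [Formula.Sat, Term.val]) ?_ ?_ k
  · simp only [hM.basic.add_zero, imp_self]
  · intro a h h'
    rw [hM.basic.add_succ, hM.basic.add_succ] at h'
    exact h (hM.basic.succ_inj _ _ h')

theorem mul_one (m : M.N) : m * 1 = m := by
  have := hM.basic.mul_succ m 0
  rwa [hM.zero_add, hM.basic.mul_zero, hM.zero_add] at this

theorem zero_mul (m : M.N) : 0 * m = 0 := by
  refine hM.sigma_induction (.eq (.mul .zero (.var 0)) .zero) (.eq _ _) (fun _ => m)
    (fun a => 0 * a = 0) (by simp [Formula.Sat, Term.val]) (hM.basic.mul_zero _) ?_ m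
  intro a h
  rw [hM.basic.mul_succ, h, hM.zero_add]

theorem mul_add (m n k : M.N) : m * (n + k) = m * n + m * k := by
  refine hM.sigma_induction (.eq (.mul (.var 2) (.add (.var 3) (.var 0)))
    (.add (.mul (.var 2) (.var 3)) (.mul (.var 2) (.var 0)))) (.eq _ _)
    (Function.update (fun _ => m) 3 n)
    (fun a => m * (n + a) = m * n + m * a) (by simp [Formula.Sat, Term.val]) ?_ ?_ k
  · simp only [hM.basic.add_zero, hM.basic.mul_zero]
  · intro a h
    rw [hM.basic.add_succ, hM.basic.mul_succ, h, hM.basic.mul_succ, hM.add_assoc]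

theorem succ_mul (m n : M.N) : (m + 1) * n = m * n + n := by
  refine hM.sigma_induction (.eq (.mul (.add (.var 2) .one) (.var 0))
    (.add (.mul (.var 2) (.var 0)) (.var 0))) (.eq _ _) (fun _ => m)
    (fun a => (m + 1) * a = m * a + a) (by simp [Formula.Sat, Term.val]) ?_ ?_ n
  · simp only [hM.basic.add_zero, hM.basic.mul_zero]
  · intro a h
    rw [hM.basic.mul_succ, h, hM.basic.mul_succ, hM.basic.add_succ (m * a + a),
      hM.basic.add_succ (m * a + m), hM.add_assoc (m * a) a m, hM.add_comm a m,
      ← hM.add_assoc (m * a) m a]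

theorem mul_comm (m n : M.N) : m * n = n * m := by
  refine hM.sigma_induction (.eq (.mul (.var 2) (.var 0)) (.mul (.var 0) (.var 2))) (.eq _ _)
    (fun _ => m) (fun a => m * a = a * m) (by simp [Formula.Sat, Term.val]) ?_ ?_ n
  · rw [hM.basic.mul_zero, hM.zero_mul]
  · intro a h
    rw [hM.basic.mul_succ, h, hM.succ_mul]

theorem mul_assoc (m n k : M.N) : m * n * k = m * (n * k) := by
  refine hM.sigma_induction (.eq (.mul (.mul (.var 2) (.var 3)) (.var 0))
    (.mul (.var 2) (.mul (.var 3) (.var 0)))) (.eq _ _) (Function.update (fun _ => m) 3 n)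
    (fun a => m * n * a = m * (n * a)) (by simp [Formula.Sat, Term.val]) ?_ ?_ k
  · simp only [hM.basic.mul_zero]
  · intro a h
    simp only [hM.basic.mul_succ, h, hM.mul_add]

theorem lt_add_succ (m k : M.N) : m < m + (k + 1) := by
  refine hM.sigma_induction (.lt (.var 2) (.add (.var 2) (.add (.var 0) .one))) (.lt _ _)
    (fun _ => m) (fun a => m < m + (a + 1)) (by simp [Formula.Sat, Term.val]) ?_ ?_ k
  · rw [hM.basic.add_succ, hM.basic.lt_succ_iff, hM.basic.add_zero]
    exact Or.inr rfl
  · intro a h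
    rw [hM.basic.add_succ, hM.basic.lt_succ_iff]
    exact Or.inl h

theorem lt_iff_exists (m n : M.N) : m < n ↔ ∃ k, n = m + (k + 1) := by
  constructor
  · refine hM.sigma_induction (.imp (.lt (.var 2) (.var 0))
      (.eq (.var 0) (.add (.var 2) (.add (.var 1) .one)))) (.imp (.lt _ _) (.eq _ _))
      (fun _ => m) (fun a => m < a → ∃ k, a = m + (k + 1)) 
      (fun V a => by
        have : Nonempty M.N := ⟨m⟩
        by_cases h : m < a <;> simp [Formula.Sat, Term.val, h]) ?_ ?_ n
    · exact fun h => (hM.basic.not_lt_zero _ h).elim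
    · intro a h ha
      rcases (hM.basic.lt_succ_iff _ _).1 ha with ha | rfl
      · obtain ⟨k, rfl⟩ := h ha
        exact ⟨k + 1, (hM.basic.add_succ _ _).symm⟩
      · exact ⟨0, by rw [hM.zero_add]⟩
  · rintro ⟨k, rfl⟩
    exact hM.lt_add_succ m k

theorem zero_lt_succ (n : M.N) : 0 < n + 1 :=
  (hM.lt_iff_exists _ _).2 ⟨n, (hM.zero_add _).symm⟩

theorem eq_zero_or_succ (n : M.N) : n = 0 ∨ ∃ k, n = k + 1 := by
  refine hM.sigma_induction (.or (.eq (.var 0) .zero) (.eq (.var 0) (.add (.var 1) .one)))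
    (.or (.eq _ _) (.eq _ _)) (fun _ => n) (fun a => a = 0 ∨ ∃ k, a = k + 1)
    (by simp [Formula.Sat, Term.val, exists_or]) (Or.inl rfl) ?_ n
  exact fun a _ => Or.inr ⟨a, rfl⟩

theorem lt_trichotomy (m n : M.N) : m < n ∨ m = n ∨ n < m := by
  refine hM.sigma_induction (.or (.lt (.var 2) (.var 0)) (.or (.eq (.var 2) (.var 0))
    (.lt (.var 0) (.var 2)))) (.or (.lt _ _) (.or (.eq _ _) (.lt _ _)))
    (fun _ => m) (fun a => m < a ∨ m = a ∨ a < m) (by simp [Formula.Sat, Term.val]) ?_ ?_ n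
  · rcases hM.eq_zero_or_succ m with rfl | ⟨k, rfl⟩
    · exact Or.inr (Or.inl rfl)
    · exact Or.inr (Or.inr (hM.zero_lt_succ k))
  · intro a h
    rcases h with h | h | h
    · exact Or.inl ((hM.basic.lt_succ_iff _ _).2 (Or.inl h))
    · exact Or.inl ((hM.basic.lt_succ_iff _ _).2 (Or.inr h))
    · obtain ⟨k, rfl⟩ := (hM.lt_iff_exists _ _).1 h
      rcases hM.eq_zero_or_succ k with rfl | ⟨k, rfl⟩
      · exact Or.inr (Or.inl (by rw [hM.zero_add]))
      · refine Or.inr (Or.inr ((hM.lt_iff_exists _ _).2 ⟨k, ?_⟩))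
        simp only [hM.basic.add_succ, hM.succ_add]

theorem lt_irrefl (m : M.N) : ¬ m < m := by
  intro h
  obtain ⟨k, hk⟩ := (hM.lt_iff_exists _ _).1 h
  have : 0 + m = (k + 1) + m := by rw [hM.zero_add, hM.add_comm _ m]; exact hk
  exact hM.basic.succ_ne_zero k (hM.add_right_cancel _ _ _ this).symm

theorem lt_trans {m n k : M.N} (h : m < n) (h' : n < k) : m < k := by
  obtain ⟨a, rfl⟩ := (hM.lt_iff_exists _ _).1 h
  obtain ⟨b, rfl⟩ := (hM.lt_iff_exists _ _).1 h'
  refine (hM.lt_iff_exists _ _).2 ⟨a + 1 + b, ?_⟩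
  rw [← hM.add_assoc, hM.basic.add_succ, hM.basic.add_succ, ← hM.add_assoc, hM.basic.add_succ]

end IsModelRCA0

section Arithmetic

variable [hM : Fact M.IsModelRCA0]

instance : CommSemiring M.N where
  add_assoc := hM.out.add_assoc
  zero_add := hM.out.zero_add
  add_zero := hM.out.basic.add_zero
  add_comm := hM.out.add_comm
  mul_assoc := hM.out.mul_assoc
  one_mul m := by rw [hM.out.mul_comm, hM.out.mul_one]
  mul_one := hM.out.mul_one
  zero_mul := hM.out.zero_mul
  mul_zero := hM.out.basic.mul_zero
  mul_comm := hM.out.mul_comm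
  left_distrib := hM.out.mul_add
  right_distrib m n k := by
    rw [hM.out.mul_comm, hM.out.mul_add, hM.out.mul_comm k, hM.out.mul_comm k]
  nsmul := nsmulRec
  npow := npowRec

open Classical in
noncomputable instance : LinearOrder M.N where
  le m n := Le m n
  lt m n := m < n
  le_refl m := Or.inr rfl
  le_trans a b c := by
    rintro (h | rfl)
    · rintro (h' | rfl)
      · exact Or.inl (hM.out.lt_trans h h')
      · exact Or.inl h
    · exact id
  lt_iff_le_not_ge a b := by
    constructor
    · refine fun h => ⟨Or.inl h, ?_⟩
      rintro (h' | rfl)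
      · exact hM.out.lt_irrefl _ (hM.out.lt_trans h h')
      · exact hM.out.lt_irrefl _ h
    · rintro ⟨h | rfl, h'⟩
      · exact h
      · exact (h' (Or.inr rfl)).elim
  le_antisymm a b := by
    rintro (h | rfl)
    · rintro (h' | rfl)
      · exact (hM.out.lt_irrefl _ (hM.out.lt_trans h h')).elim
      · rfl
    · exact fun _ => rfl
  le_total a b := by
    rcases hM.out.lt_trichotomy a b with h | h | h
    · exact Or.inl (Or.inl h)
    · exact Or.inl (Or.inr h)
    · exact Or.inr (Or.inl h)
  toDecidableLE := inferInstance

theorem Le_iff_le (m n : M.N) : Le m n ↔ m ≤ n := Iff.rfl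

theorem le_iff_exists_add' (m n : M.N) : m ≤ n ↔ ∃ k, n = m + k := by
  constructor
  · rintro (h | rfl)
    · obtain ⟨k, rfl⟩ := (hM.out.lt_iff_exists _ _).1 h
      exact ⟨k + 1, rfl⟩
    · exact ⟨0, (add_zero _).symm⟩
  · rintro ⟨k, rfl⟩
    rcases hM.out.eq_zero_or_succ k with rfl | ⟨k, rfl⟩
    · exact Or.inr (add_zero _).symm
    · exact Or.inl (hM.out.lt_add_succ m k)

instance : IsCancelAdd M.N where
  add_left_cancel m a b h := hM.out.add_right_cancel a b m (by rwa [add_comm a, add_comm b])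
  add_right_cancel m a b h := hM.out.add_right_cancel a b m h

instance : IsOrderedAddMonoid M.N where
  add_le_add_left a b h c := by
    obtain ⟨k, rfl⟩ := (le_iff_exists_add' _ _).1 h
    exact (le_iff_exists_add' _ _).2 ⟨k, by ring⟩

instance : CanonicallyOrderedAdd M.N where
  exists_add_of_le h := (le_iff_exists_add' _ _).1 h
  le_self_add _ b := (le_iff_exists_add' _ _).2 ⟨b, rfl⟩
  le_add_self _ b := (le_iff_exists_add' _ _).2 ⟨b, add_comm _ _⟩

instance : IsStrictOrderedRing M.N where
  add_le_add_left a b h c := by gcongr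
  le_of_add_le_add_left a b c h := by
    obtain ⟨k, hk⟩ := (le_iff_exists_add' _ _).1 h
    refine (le_iff_exists_add' _ _).2 ⟨k, add_left_cancel (a := a) ?_⟩
    rw [hk, add_assoc]
  zero_le_one := (le_iff_exists_add' _ _).2 ⟨1, (zero_add _).symm⟩
  exists_pair_ne := ⟨0, 1, fun h => hM.out.basic.succ_ne_zero (0 : M.N) (by rw [zero_add, ← h])⟩
  mul_lt_mul_of_pos_left a ha b c hbc := by
    obtain ⟨k, rfl⟩ := (hM.out.lt_iff_exists _ _).1 hbc
    obtain ⟨l, rfl⟩ := (hM.out.lt_iff_exists _ _).1 ha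
    exact (hM.out.lt_iff_exists _ _).2 ⟨l * k + l + k, by ring⟩
  mul_lt_mul_of_pos_right a ha b c hbc := by
    obtain ⟨k, rfl⟩ := (hM.out.lt_iff_exists _ _).1 hbc
    obtain ⟨l, rfl⟩ := (hM.out.lt_iff_exists _ _).1 ha
    exact (hM.out.lt_iff_exists _ _).2 ⟨l * k + l + k, by ring⟩

theorem lt_add_one_iff (m n : M.N) : m < n + 1 ↔ m ≤ n := hM.out.basic.lt_succ_iff m n

theorem add_one_le_iff (m n : M.N) : m + 1 ≤ n ↔ m < n := by
  rw [← lt_add_one_iff]; exact add_lt_add_iff_right 1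

theorem pair_inj {a b c d : M.N} : pair a b = pair c d ↔ a = c ∧ b = d := by
  refine ⟨fun h => ?_, by rintro ⟨rfl, rfl⟩; rfl⟩
  simp only [pair] at h
  -- `pair a b` lies between the squares of `a + b` and `a + b + 1`
  have key : ∀ s t a c : M.N, a ≤ s → s * s + a = t * t + c → ¬ s < t := by
    intro s t a c ha h hst
    obtain ⟨k, rfl⟩ := (hM.out.lt_iff_exists _ _).1 hst
    have h1 : s * s + a < (s + (k + 1)) * (s + (k + 1)) + c := by
      obtain ⟨l, rfl⟩ := (le_iff_exists_add' _ _).1 ha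
      refine (hM.out.lt_iff_exists _ _).2 ⟨(a + l) + l + 2 * k * (a + l) + k * k + 2 * k + c, ?_⟩
      ring
    exact h1.ne h
  have hs : a + b = c + d := by
    rcases lt_trichotomy (a + b) (c + d) with h' | h' | h'
    · exact (key _ _ _ _ le_self_add h h').elim
    · exact h'
    · exact (key _ _ _ _ le_self_add h.symm h').elim
  rw [hs] at h
  have hac : a = c := add_left_cancel h
  subst hac
  exact ⟨rfl, add_left_cancel hs⟩

theorem le_pair_left (a b : M.N) : a ≤ pair a b := le_add_self

theorem le_pair_right (a b : M.N) : b ≤ pair a b := by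
  rcases eq_or_ne b 0 with rfl | hb
  · exact zero_le
  · have h1 : (1 : M.N) ≤ a + b := by
      rw [← zero_add (1 : M.N), add_one_le_iff]
      exact (pos_iff_ne_zero.2 hb).trans_le le_add_self
    calc b ≤ (a + b) * 1 := by rw [mul_one]; exact le_add_self
      _ ≤ (a + b) * (a + b) := by gcongr
      _ ≤ pair a b := le_self_add

end Arithmetic

/-! ### Comprehension and induction without formulas -/

/-- The term for `pair s t`. -/
def pairTerm (s t : Term) : Term := .add (.mul (.add s t) (.add s t)) s

section Comprehension

variable [hM : Fact M.IsModelRCA0]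

/-- `Δ⁰₁` comprehension, with the matrices given semantically. -/
theorem delta_comprehension (V : ℕ → M.sets) {φ ψ : Formula} (hφ : φ.IsBounded)
    (hψ : ψ.IsBounded) (P Q : M.N → M.N → Prop) (hP : ∀ v, φ.Sat M v V ↔ P (v 0) (v 1))
    (hQ : ∀ v, ψ.Sat M v V ↔ Q (v 0) (v 1)) (h : ∀ a, (∃ b, P a b) ↔ ∀ b, Q a b) :
    {a | ∃ b, P a b} ∈ M.sets := by
  have := hM.out.comprehension (.ex 1 φ) (.all 1 ψ) ⟨1, φ, hφ, rfl⟩ ⟨1, ψ, hψ, rfl⟩ 0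
    (fun _ => 0) V
  simp only [Formula.Sat, hP, hQ] at this
  simpa using this (by simpa using h)

theorem bounded_comprehension (V : ℕ → M.sets) {φ : Formula} (hφ : φ.IsBounded)
    (P : M.N → Prop) (hP : ∀ v, φ.Sat M v V ↔ P (v 0)) : {a | P a} ∈ M.sets := by
  simpa using delta_comprehension V hφ hφ (fun a _ => P a) (fun a _ => P a) hP hP (by simp)

/-- Comprehension for sets of pairs; the variables `1` and `2` of `φ` stand for the components. -/
theorem pair_comprehension (V : ℕ → M.sets) {φ : Formula} (hφ : φ.IsBounded)
    (P : M.N → M.N → Prop) (hP : ∀ v, φ.Sat M v V ↔ P (v 1) (v 2)) :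
    {c | ∃ x y, c = pair x y ∧ P x y} ∈ M.sets := by
  refine bounded_comprehension V (φ := .ex 1 (.and (.lt (.var 1) (.add (.var 0) .one))
    (.ex 2 (.and (.lt (.var 2) (.add (.var 0) .one))
      (.and (.eq (.var 0) (pairTerm (.var 1) (.var 2))) φ)))))
    (.bex (by simp [Term.Occurs]) (.bex (by simp [Term.Occurs]) (.and (.eq _ _) hφ))) _ ?_
  intro v
  simp only [Formula.Sat, Term.val, hP, pairTerm, lt_add_one_iff]
  constructor
  · rintro ⟨x, -, y, -, h⟩
    exact ⟨x, y, by simpa [pair] using h⟩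
  · rintro ⟨x, y, h, h'⟩
    have h1 := le_pair_left x y
    have h2 := le_pair_right x y
    rw [← h] at h1 h2
    exact ⟨x, by simpa using h1, y, by simpa using h2, by simpa [pair] using ⟨h, h'⟩⟩

/-- Comprehension for sets of triples; the variables `3`, `4` and `2` of `φ` stand for the
components. -/
theorem triple_comprehension (V : ℕ → M.sets) {φ : Formula} (hφ : φ.IsBounded)
    (P : M.N → M.N → M.N → Prop) (hP : ∀ v, φ.Sat M v V ↔ P (v 3) (v 4) (v 2)) :
    {c | ∃ x y z, c = pair (pair x y) z ∧ P x y z} ∈ M.sets := by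
  have := pair_comprehension V (φ := .ex 3 (.and (.lt (.var 3) (.add (.var 1) .one))
    (.ex 4 (.and (.lt (.var 4) (.add (.var 1) .one))
      (.and (.eq (.var 1) (pairTerm (.var 3) (.var 4))) φ)))))
    (.bex (by simp [Term.Occurs]) (.bex (by simp [Term.Occurs]) (.and (.eq _ _) hφ)))
    (fun w z => ∃ x y, w = pair x y ∧ P x y z) ?_
  · convert this using 3 with c
    constructor
    · rintro ⟨x, y, z, h, h'⟩
      exact ⟨_, z, h, x, y, rfl, h'⟩
    · rintro ⟨_, z, h, x, y, rfl, h'⟩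
      exact ⟨x, y, z, h, h'⟩
  intro v
  simp only [Formula.Sat, Term.val, hP, pairTerm, lt_add_one_iff]
  constructor
  · rintro ⟨x, -, y, -, h⟩
    exact ⟨x, y, by simpa [pair] using h⟩
  · rintro ⟨x, y, h, h'⟩
    have h1 := le_pair_left x y
    have h2 := le_pair_right x y
    rw [← h] at h1 h2
    exact ⟨x, by simpa using h1, y, by simpa using h2, by simpa [pair] using ⟨h, h'⟩⟩

theorem univ_mem : (Set.univ : Set M.N) ∈ M.sets := by
  obtain ⟨A, hA⟩ := M.sets_nonempty
  exact bounded_comprehension (fun _ => ⟨A, hA⟩) (.eq .zero .zero) (fun _ => True)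
    (by simp [Formula.Sat])

theorem compl_mem {A : Set M.N} (hA : A ∈ M.sets) : Aᶜ ∈ M.sets :=
  bounded_comprehension (fun _ => ⟨A, hA⟩) (.not (.mem (.var 0) 0)) (fun a => a ∉ A)
    (by simp [Formula.Sat, Term.val])

/-- The assignment of set variables with value `A` at `0` and `B` elsewhere. -/
def twoSets (A B : M.sets) (n : ℕ) : M.sets := if n = 0 then A else B

theorem inter_mem {A B : Set M.N} (hA : A ∈ M.sets) (hB : B ∈ M.sets) : A ∩ B ∈ M.sets :=
  bounded_comprehension (twoSets ⟨A, hA⟩ ⟨B, hB⟩) (.and (.mem (.var 0) 0) (.mem (.var 0) 1))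
    (fun a => a ∈ A ∧ a ∈ B) (by simp [Formula.Sat, Term.val, twoSets])

theorem prod_mem {A B : Set M.N} (hA : A ∈ M.sets) (hB : B ∈ M.sets) :
    {c | ∃ x y, c = pair x y ∧ x ∈ A ∧ y ∈ B} ∈ M.sets :=
  pair_comprehension (twoSets ⟨A, hA⟩ ⟨B, hB⟩) (.and (.mem (.var 1) 0) (.mem (.var 2) 1))
    (fun x y => x ∈ A ∧ y ∈ B) (by simp [Formula.Sat, Term.val, twoSets])

/-- Projections of sets of the structure, when they are `Δ⁰₁`. -/
theorem proj_mem {A B : Set M.N} (hA : A ∈ M.sets) (hB : B ∈ M.sets)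
    (h : ∀ a, (∃ b, pair a b ∈ A) ↔ ∀ b, pair a b ∈ B) : {a | ∃ b, pair a b ∈ A} ∈ M.sets :=
  delta_comprehension (twoSets ⟨A, hA⟩ ⟨B, hB⟩) (.mem (pairTerm (.var 0) (.var 1)) 0)
    (.mem (pairTerm (.var 0) (.var 1)) 1) (fun a b => pair a b ∈ A) (fun a b => pair a b ∈ B)
    (by simp [Formula.Sat, Term.val, twoSets, pairTerm, pair])
    (by simp [Formula.Sat, Term.val, twoSets, pairTerm, pair]) h

end Comprehension

/-! ### Relations and functions of a structure -/

/-- A type of tuples of elements of `M.N`, coded by iterated pairing. -/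
class Ctx (M : L2Structure.{u}) (α : Type u) where
  enc : α → M.N
  enc_injective : Function.Injective enc
  range_mem : Set.range enc ∈ M.sets

/-- The relation `P` belongs to the structure. -/
class IsRel (M : L2Structure.{u}) {α : Type u} [Ctx M α] (P : α → Prop) : Prop where
  mem : Ctx.enc (M := M) '' {a | P a} ∈ M.sets

/-- The function `t` belongs to the structure. -/
class IsMap (M : L2Structure.{u}) {α : Type u} [Ctx M α] (t : α → M.N) : Prop where
  mem : {c | ∃ a : α, c = pair (Ctx.enc (M := M) a) (t a)} ∈ M.sets

section Definability

variable [hM : Fact M.IsModelRCA0] {α : Type u} [Ctx M α]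

instance : Ctx M M.N where
  enc := id
  enc_injective := Function.injective_id
  range_mem := by rw [Set.range_id]; exact univ_mem

instance : Ctx M (α × M.N) where
  enc p := pair (Ctx.enc p.1) p.2
  enc_injective p q h := by
    obtain ⟨h1, h2⟩ := pair_inj.1 h
    exact Prod.ext (Ctx.enc_injective h1) h2
  range_mem := by
    convert prod_mem (Ctx.range_mem (M := M) (α := α)) univ_mem using 1
    ext c
    constructor
    · rintro ⟨p, rfl⟩
      exact ⟨_, _, rfl, ⟨_, rfl⟩, trivial⟩
    · rintro ⟨_, y, rfl, ⟨a, rfl⟩, -⟩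
      exact ⟨(a, y), rfl⟩

omit hM in
theorem enc_mem_image {P : α → Prop} {a : α} :
    Ctx.enc (M := M) a ∈ Ctx.enc (M := M) '' {a | P a} ↔ P a :=
  Ctx.enc_injective.mem_set_image

theorem IsRel.setOf_mem (P : M.N → Prop) [h : IsRel M P] : {a | P a} ∈ M.sets := by
  have := h.mem
  rwa [show (Ctx.enc (M := M) : M.N → M.N) = id from rfl, Set.image_id] at this

theorem IsRel.pair_mem (P : M.N → M.N → Prop) [h : IsRel M fun p : M.N × M.N => P p.1 p.2] :
    {c | ∃ x y, c = pair x y ∧ P x y} ∈ M.sets := by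
  convert h.mem using 1
  ext c
  constructor
  · rintro ⟨x, y, rfl, h⟩
    exact ⟨(x, y), h, rfl⟩
  · rintro ⟨⟨x, y⟩, h, rfl⟩
    exact ⟨x, y, rfl, h⟩

instance IsRel.not (P : α → Prop) [h : IsRel M P] : IsRel M fun a => ¬ P a := by
  constructor
  convert inter_mem (Ctx.range_mem (M := M) (α := α)) (compl_mem h.mem) using 1
  ext c
  constructor
  · rintro ⟨a, ha, rfl⟩
    exact ⟨⟨a, rfl⟩, fun h' => ha (enc_mem_image.1 h')⟩
  · rintro ⟨⟨a, rfl⟩, ha⟩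
    exact ⟨a, fun h' => ha (enc_mem_image.2 h'), rfl⟩

instance IsRel.and (P Q : α → Prop) [h : IsRel M P] [h' : IsRel M Q] :
    IsRel M fun a => P a ∧ Q a := by
  constructor
  convert inter_mem h.mem h'.mem using 1
  exact Set.image_inter Ctx.enc_injective

instance IsRel.or (P Q : α → Prop) [h : IsRel M P] [h' : IsRel M Q] :
    IsRel M fun a => P a ∨ Q a := by
  simp only [or_iff_not_and_not]; infer_instance

instance IsRel.imp (P Q : α → Prop) [h : IsRel M P] [h' : IsRel M Q] :
    IsRel M fun a => P a → Q a := by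
  simp only [imp_iff_not_or]; infer_instance

instance IsRel.iff (P Q : α → Prop) [h : IsRel M P] [h' : IsRel M Q] :
    IsRel M fun a => P a ↔ Q a := by
  simp only [iff_iff_implies_and_implies]; infer_instance

/-- Quantification, when the result is `Δ⁰₁`. -/
theorem IsRel.delta (P Q : α → M.N → Prop) [hP : IsRel M fun p : α × M.N => P p.1 p.2]
    [hQ : IsRel M fun p : α × M.N => Q p.1 p.2] (h : ∀ a, (∃ b, P a b) ↔ ∀ b, Q a b) :
    IsRel M fun a => ∃ b, P a b := by
  constructor
  convert proj_mem hP.mem hQ.mem ?_ using 1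
  · ext c
    constructor
    · rintro ⟨a, ⟨b, hb⟩, rfl⟩
      exact ⟨b, (a, b), hb, rfl⟩
    · rintro ⟨b, ⟨⟨a, b'⟩, hb, h'⟩⟩
      obtain ⟨rfl, rfl⟩ := pair_inj.1 h'
      exact ⟨a, ⟨_, hb⟩, rfl⟩
  · intro c
    constructor
    · rintro ⟨b, ⟨⟨a, b'⟩, hb, h'⟩⟩
      obtain ⟨rfl, rfl⟩ := pair_inj.1 h'
      exact fun b => ⟨(a, b), (h a).1 ⟨_, hb⟩ b, rfl⟩
    · intro hc
      obtain ⟨⟨a, b'⟩, -, h'⟩ := hc 0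
      obtain ⟨rfl, -⟩ := pair_inj.1 h'
      obtain ⟨b, hb⟩ := (h a).2 fun b => by
        obtain ⟨⟨a', b'⟩, hb, h'⟩ := hc b
        obtain ⟨h1, rfl⟩ := pair_inj.1 h'
        obtain rfl := Ctx.enc_injective h1
        exact hb
      exact ⟨b, (a, b), hb, rfl⟩

theorem IsMap.graph (t : α → M.N) [h : IsMap M t] : IsRel M fun p : α × M.N => p.2 = t p.1 := by
  constructor
  convert h.mem using 1
  ext c
  constructor
  · rintro ⟨⟨a, b⟩, h, rfl⟩
    exact ⟨a, by rw [← show b = t a from h]; rfl⟩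
  · rintro ⟨a, rfl⟩
    exact ⟨(a, t a), rfl, rfl⟩

theorem IsMap.of_graph (t : α → M.N) [h : IsRel M fun p : α × M.N => p.2 = t p.1] :
    IsMap M t := by
  constructor
  convert h.mem using 1
  ext c
  constructor
  · rintro ⟨a, rfl⟩
    exact ⟨(a, t a), rfl, rfl⟩
  · rintro ⟨⟨a, b⟩, h, rfl⟩
    exact ⟨a, by rw [← show b = t a from h]; rfl⟩

/-- Substitution of a function of the structure for the last variable. -/
theorem IsRel.subst (P : α → M.N → Prop) (t : α → M.N)
    [hP : IsRel M fun p : α × M.N => P p.1 p.2] [ht : IsMap M t] :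
    IsRel M fun a => P a (t a) := by
  have := ht.graph
  have := IsRel.delta (M := M) (fun a b => b = t a ∧ P a b) (fun a b => b = t a → P a b) (by simp)
  simpa using this

theorem IsRel.snd_mem {A : Set M.N} (hA : A ∈ M.sets) : IsRel M fun p : α × M.N => p.2 ∈ A := by
  constructor
  convert prod_mem (Ctx.range_mem (M := M) (α := α)) hA using 1
  ext c
  constructor
  · rintro ⟨⟨a, b⟩, h, rfl⟩
    exact ⟨_, _, rfl, ⟨a, rfl⟩, h⟩
  · rintro ⟨_, b, rfl, ⟨a, rfl⟩, h⟩
    exact ⟨(a, b), h, rfl⟩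

theorem IsRel.mem_of_mem {A : Set M.N} (hA : A ∈ M.sets) (t : α → M.N) [ht : IsMap M t] :
    IsRel M fun a => t a ∈ A := by
  have := IsRel.snd_mem (α := α) hA
  exact IsRel.subst (fun _ b => b ∈ A) t


instance IsRel.mem_sets {A : Set M.N} [hA : Fact (A ∈ M.sets)] (t : α → M.N) [IsMap M t] :
    IsRel M fun a => t a ∈ A :=
  IsRel.mem_of_mem hA.out t

theorem graph_mem_iff {t : α → M.N} (x b : M.N) :
    pair x b ∈ {c | ∃ a : α, c = pair (Ctx.enc (M := M) a) (t a)} ↔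
      ∃ a, x = Ctx.enc (M := M) a ∧ b = t a := by
  simp only [Set.mem_ofPred_eq, pair_inj]

theorem const_mem (c : M.N) : {a | a = c} ∈ M.sets := by
  obtain ⟨A, hA⟩ := M.sets_nonempty
  have := hM.out.comprehension (.ex 1 (.eq (.var 0) (.var 2))) (.all 1 (.eq (.var 0) (.var 2)))
    ⟨1, _, .eq _ _, rfl⟩ ⟨1, _, .eq _ _, rfl⟩ 0 (fun _ => c) (fun _ => ⟨A, hA⟩)
  simpa [Formula.Sat, Term.val] using this

instance IsMap.const (c : M.N) : IsMap M fun _ : α => c := by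
  constructor
  convert prod_mem (Ctx.range_mem (M := M) (α := α)) (const_mem c) using 1
  ext c
  simp

/-- Weakening: a further variable may be added to the context. -/
theorem IsMap.weaken (t : α → M.N) [h : IsMap M t] : IsMap M fun p : α × M.N => t p.1 := by
  constructor
  convert triple_comprehension (fun _ => ⟨_, h.mem⟩) (.mem (pairTerm (.var 3) (.var 2)) 0)
    (fun x _ z => pair x z ∈ {c | ∃ a : α, c = pair (Ctx.enc (M := M) a) (t a)})
    (by simp [Formula.Sat, Term.val, pairTerm, pair]) using 1
  ext c
  simp only [graph_mem_iff]
  constructor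
  · rintro ⟨⟨a, b⟩, rfl⟩
    exact ⟨_, _, _, rfl, a, rfl, rfl⟩
  · rintro ⟨_, y, _, rfl, a, rfl, rfl⟩
    exact ⟨(a, y), rfl⟩

instance IsMap.snd : IsMap M fun p : α × M.N => p.2 := by
  constructor
  convert triple_comprehension (fun _ => ⟨_, Ctx.range_mem (M := M) (α := α)⟩)
    (.and (.mem (.var 3) 0) (.eq (.var 4) (.var 2)))
    (fun x y z => x ∈ Set.range (Ctx.enc (M := M) : α → M.N) ∧ y = z)
    (by simp [Formula.Sat, Term.val]) using 1
  ext c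
  constructor
  · rintro ⟨⟨a, b⟩, rfl⟩
    exact ⟨_, _, _, rfl, ⟨a, rfl⟩, rfl⟩
  · rintro ⟨_, y, _, rfl, ⟨a, rfl⟩, rfl⟩
    exact ⟨(a, y), rfl⟩

instance IsMap.id : IsMap M fun a : M.N => a := by
  constructor
  obtain ⟨A, hA⟩ := M.sets_nonempty
  convert pair_comprehension (fun _ => ⟨A, hA⟩) (.eq (.var 1) (.var 2)) (fun x y => x = y)
    (by simp [Formula.Sat, Term.val]) using 1
  ext c
  simp [Ctx.enc]

instance IsMap.pair (t s : α → M.N) [ht : IsMap M t] [hs : IsMap M s] :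
    IsMap M fun a => L2Structure.pair (t a) (s a) := by
  constructor
  convert pair_comprehension (twoSets ⟨_, ht.mem⟩ ⟨_, hs.mem⟩)
    (φ := .ex 3 (.and (.lt (.var 3) (.add (.var 2) .one)) (.ex 4 (.and (.lt (.var 4)
      (.add (.var 2) .one)) (.and (.eq (.var 2) (pairTerm (.var 3) (.var 4)))
      (.and (.mem (pairTerm (.var 1) (.var 3)) 0) (.mem (pairTerm (.var 1) (.var 4)) 1)))))))
    (.bex (by simp [Term.Occurs]) (.bex (by simp [Term.Occurs])
      (.and (.eq _ _) (.and (.mem _ _) (.mem _ _)))))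
    (fun x c => ∃ y < c + 1, ∃ z < c + 1, c = L2Structure.pair y z ∧
      L2Structure.pair x y ∈ {c | ∃ a : α, c = L2Structure.pair (Ctx.enc (M := M) a) (t a)} ∧
      L2Structure.pair x z ∈ {c | ∃ a : α, c = L2Structure.pair (Ctx.enc (M := M) a) (s a)})
    (by simp [Formula.Sat, Term.val, pairTerm, L2Structure.pair, twoSets]) using 1
  ext c
  simp only [graph_mem_iff, lt_add_one_iff]
  constructor
  · rintro ⟨a, rfl⟩
    exact ⟨_, _, rfl, _, le_pair_left _ _, _, le_pair_right _ _, rfl, ⟨a, rfl, rfl⟩, ⟨a, rfl, rfl⟩⟩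
  · rintro ⟨x, d, rfl, y, -, z, -, rfl, ⟨a, rfl, rfl⟩, a', h, rfl⟩
    rw [Ctx.enc_injective h]
    exact ⟨a', rfl⟩

section Projections

-- The projections from contexts with at most seven variables. Instance resolution cannot recognize
-- `fun p => p.1.2` as an instance of `IsMap.weaken`, so they are listed.

instance IsMap.snd₁ : IsMap M fun p : (α × M.N) × M.N => p.1.2 :=
  IsMap.weaken _ (h := IsMap.snd)

instance IsMap.snd₂ : IsMap M fun p : ((α × M.N) × M.N) × M.N => p.1.1.2 :=
  IsMap.weaken _ (h := IsMap.snd₁)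

instance IsMap.snd₃ : IsMap M fun p : (((α × M.N) × M.N) × M.N) × M.N => p.1.1.1.2 :=
  IsMap.weaken _ (h := IsMap.snd₂)

instance IsMap.snd₄ : IsMap M fun p : ((((α × M.N) × M.N) × M.N) × M.N) × M.N => p.1.1.1.1.2 :=
  IsMap.weaken _ (h := IsMap.snd₃)

instance IsMap.snd₅ :
    IsMap M fun p : (((((α × M.N) × M.N) × M.N) × M.N) × M.N) × M.N => p.1.1.1.1.1.2 :=
  IsMap.weaken _ (h := IsMap.snd₄)

instance IsMap.fst₁ : IsMap M fun p : M.N × M.N => p.1 :=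
  IsMap.weaken _ (h := IsMap.id)

instance IsMap.fst₂ : IsMap M fun p : (M.N × M.N) × M.N => p.1.1 :=
  IsMap.weaken _ (h := IsMap.fst₁)

instance IsMap.fst₃ : IsMap M fun p : ((M.N × M.N) × M.N) × M.N => p.1.1.1 :=
  IsMap.weaken _ (h := IsMap.fst₂)

instance IsMap.fst₄ : IsMap M fun p : (((M.N × M.N) × M.N) × M.N) × M.N => p.1.1.1.1 :=
  IsMap.weaken _ (h := IsMap.fst₃)

instance IsMap.fst₅ : IsMap M fun p : ((((M.N × M.N) × M.N) × M.N) × M.N) × M.N => p.1.1.1.1.1 :=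
  IsMap.weaken _ (h := IsMap.fst₄)

instance IsMap.fst₆ :
    IsMap M fun p : (((((M.N × M.N) × M.N) × M.N) × M.N) × M.N) × M.N => p.1.1.1.1.1.1 :=
  IsMap.weaken _ (h := IsMap.fst₅)

end Projections

theorem IsRel.comp₁ (P : M.N → Prop) [h : IsRel M P] (t : α → M.N) [IsMap M t] :
    IsRel M fun a => P (t a) :=
  mem_of_mem (IsRel.setOf_mem P) t

theorem IsRel.comp₂ (R : M.N → M.N → Prop) [h : IsRel M fun p : M.N × M.N => R p.1 p.2]
    (t s : α → M.N) [IsMap M t] [IsMap M s] : IsRel M fun a => R (t a) (s a) := by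
  have := mem_of_mem h.mem (fun a => L2Structure.pair (t a) (s a))
  convert this with a
  exact (enc_mem_image (a := (t a, s a)) (P := fun p : M.N × M.N => R p.1 p.2)).symm

theorem IsRel.comp₃ (R : M.N → M.N → M.N → Prop)
    [h : IsRel M fun p : (M.N × M.N) × M.N => R p.1.1 p.1.2 p.2]
    (t s r : α → M.N) [IsMap M t] [IsMap M s] [IsMap M r] :
    IsRel M fun a => R (t a) (s a) (r a) := by
  have := mem_of_mem h.mem (fun a => L2Structure.pair (L2Structure.pair (t a) (s a)) (r a))
  convert this with a
  exact (enc_mem_image (a := ((t a, s a), r a))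
    (P := fun p : (M.N × M.N) × M.N => R p.1.1 p.1.2 p.2)).symm

instance IsRel.eq (t s : α → M.N) [IsMap M t] [IsMap M s] : IsRel M fun a => t a = s a := by
  have : IsRel M fun p : M.N × M.N => p.1 = p.2 := by
    convert IsMap.graph (M := M) (fun a : M.N => a) using 2
    exact eq_comm
  exact IsRel.comp₂ (fun x y => x = y) t s

instance IsRel.lt (t s : α → M.N) [IsMap M t] [IsMap M s] : IsRel M fun a => t a < s a := by
  have : IsRel M fun p : M.N × M.N => p.1 < p.2 := by
    obtain ⟨A, hA⟩ := M.sets_nonempty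
    constructor
    convert pair_comprehension (fun _ => ⟨A, hA⟩) (.lt (.var 1) (.var 2)) (fun x y => x < y)
      (by simp [Formula.Sat, Term.val]) using 1
    ext c
    constructor
    · rintro ⟨⟨x, y⟩, h, rfl⟩
      exact ⟨x, y, rfl, h⟩
    · rintro ⟨x, y, rfl, h⟩
      exact ⟨(x, y), h, rfl⟩
  exact IsRel.comp₂ (fun x y => x < y) t s

instance IsRel.le (t s : α → M.N) [IsMap M t] [IsMap M s] : IsRel M fun a => t a ≤ s a := by
  simp only [← not_lt]; infer_instance

instance IsRel.ne (t s : α → M.N) [IsMap M t] [IsMap M s] : IsRel M fun a => t a ≠ s a :=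
  IsRel.not _

theorem IsMap.of_triple (f : M.N → M.N → M.N)
    (h : {c | ∃ x y z, c = L2Structure.pair (L2Structure.pair x y) z ∧ z = f x y} ∈ M.sets)
    (t s : α → M.N) [IsMap M t] [IsMap M s] : IsMap M fun a => f (t a) (s a) := by
  have : IsRel M fun p : (M.N × M.N) × M.N => p.2 = f p.1.1 p.1.2 := by
    constructor
    convert h using 1
    ext c
    constructor
    · rintro ⟨⟨⟨x, y⟩, z⟩, h, rfl⟩
      exact ⟨x, y, z, rfl, h⟩
    · rintro ⟨x, y, z, rfl, h⟩
      exact ⟨((x, y), z), h, rfl⟩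
  have h1 := IsMap.weaken t
  have h2 := IsMap.weaken s
  have := IsRel.comp₃ (fun x y z => z = f x y) (fun p : α × M.N => t p.1) (fun p => s p.1)
    (fun p => p.2)
  exact IsMap.of_graph _

instance IsMap.add (t s : α → M.N) [IsMap M t] [IsMap M s] : IsMap M fun a => t a + s a := by
  obtain ⟨A, hA⟩ := M.sets_nonempty
  exact IsMap.of_triple (fun x y => x + y) (triple_comprehension (fun _ => ⟨A, hA⟩)
    (.eq (.var 2) (.add (.var 3) (.var 4))) (fun x y z => z = x + y)
    (by simp [Formula.Sat, Term.val])) t s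

instance IsMap.mul (t s : α → M.N) [IsMap M t] [IsMap M s] : IsMap M fun a => t a * s a := by
  obtain ⟨A, hA⟩ := M.sets_nonempty
  exact IsMap.of_triple (fun x y => x * y) (triple_comprehension (fun _ => ⟨A, hA⟩)
    (.eq (.var 2) (.mul (.var 3) (.var 4))) (fun x y z => z = x * y)
    (by simp [Formula.Sat, Term.val])) t s

-- Instance resolution meets functions such as `fun b => pair c b` in their eta-reduced form, which
-- the general instances do not match.

instance IsMap.pair_left (c : M.N) : IsMap M (L2Structure.pair c) :=
  IsMap.pair (fun _ => c) fun a => a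

instance IsRel.mem_left {A : Set M.N} [hA : Fact (A ∈ M.sets)] : IsRel M fun a => a ∈ A :=
  IsRel.mem_sets fun a => a

instance IsRel.lt_left (c : M.N) : IsRel M fun a => c < a :=
  IsRel.lt (fun _ => c) fun a => a

instance IsRel.le_left (c : M.N) : IsRel M fun a => c ≤ a :=
  IsRel.le (fun _ => c) fun a => a

theorem IsMap.comp (f : M.N → M.N) [h : IsMap M f] (t : α → M.N) [IsMap M t] :
    IsMap M fun a => f (t a) := by
  have h1 := IsMap.weaken t
  have := h.graph
  have := IsRel.comp₂ (fun x z => z = f x) (fun p : α × M.N => t p.1) (fun p => p.2)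
  exact IsMap.of_graph _

instance IsRel.true : IsRel M fun _ : α => True := by
  have : IsRel M fun _ : α => (0 : M.N) = 0 := inferInstance
  simpa using this

instance IsRel.const (p : Prop) : IsRel M fun _ : α => p := by
  by_cases hp : p
  · simp only [hp]; infer_instance
  · have : IsRel M fun _ : α => ¬ True := inferInstance
    simpa [hp] using this

instance IsRel.ball (t : α → M.N) (Q : α → M.N → Prop)
    [hQ : IsRel M fun p : α × M.N => Q p.1 p.2] [IsMap M t] :
    IsRel M fun a => ∀ b, b < t a → Q a b := by
  have : IsRel M fun p : α × M.N => ∀ b, b < p.2 → Q p.1 b := by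
    constructor
    convert pair_comprehension (twoSets ⟨_, hQ.mem⟩ ⟨_, Ctx.range_mem (M := M) (α := α)⟩)
      (φ := .and (.mem (.var 1) 1) (.all 3 (.imp (.lt (.var 3) (.var 2))
        (.mem (pairTerm (.var 1) (.var 3)) 0))))
      (.and (.mem _ _) (.ball (by simp [Term.Occurs]) (.mem _ _)))
      (fun x y => x ∈ Set.range (Ctx.enc (M := M) : α → M.N) ∧
        ∀ b, b < y → L2Structure.pair x b ∈
          Ctx.enc (M := M) '' {p : α × M.N | Q p.1 p.2})
      (by simp [Formula.Sat, Term.val, pairTerm, L2Structure.pair, twoSets]) using 1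
    ext c
    constructor
    · rintro ⟨⟨a, b⟩, h, rfl⟩
      exact ⟨_, _, rfl, ⟨a, rfl⟩, fun d hd => ⟨(a, d), h d hd, rfl⟩⟩
    · rintro ⟨_, b, rfl, ⟨a, rfl⟩, h⟩
      exact ⟨(a, b), fun d hd => (enc_mem_image (a := (a, d))).1 (h d hd), rfl⟩
  exact IsRel.subst (fun a y => ∀ b, b < y → Q a b) t

instance IsRel.bex (t : α → M.N) (Q : α → M.N → Prop)
    [hQ : IsRel M fun p : α × M.N => Q p.1 p.2] [IsMap M t] :
    IsRel M fun a => ∃ b, b < t a ∧ Q a b := by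
  have : IsRel M fun a => ¬ ∀ b, b < t a → ¬ Q a b := inferInstance
  simpa using this

instance IsRel.ball_le (t : α → M.N) (Q : α → M.N → Prop)
    [hQ : IsRel M fun p : α × M.N => Q p.1 p.2] [IsMap M t] :
    IsRel M fun a => ∀ b, b ≤ t a → Q a b := by
  simp only [← lt_add_one_iff]; infer_instance

instance IsRel.bex_le (t : α → M.N) (Q : α → M.N → Prop)
    [hQ : IsRel M fun p : α × M.N => Q p.1 p.2] [IsMap M t] :
    IsRel M fun a => ∃ b, b ≤ t a ∧ Q a b := by
  simp only [← lt_add_one_iff]; infer_instance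

/-- Induction for relations of the structure. -/
theorem IsRel.induction (P : M.N → Prop) [h : IsRel M P] (h0 : P 0)
    (hs : ∀ a, P a → P (a + 1)) (a : M.N) : P a := by
  have := hM.out.induction (.ex 1 (.mem (.var 0) 0)) ⟨1, _, .mem _ _, rfl⟩ 0 (fun _ => 0)
    (fun _ => ⟨_, IsRel.setOf_mem P⟩)
  simp only [Formula.Sat, Term.val] at this
  simp at this
  exact this h0 hs a

theorem IsRel.strong_induction (P : M.N → Prop) [h : IsRel M P]
    (hs : ∀ a, (∀ b < a, P b) → P a) (a : M.N) : P a := by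
  have : IsRel M fun p : M.N × M.N => P p.2 := IsRel.comp₁ P _
  refine IsRel.induction (fun a => ∀ b, b < a → P b) (by simp) ?_ (a + 1) a
    ((lt_add_one_iff _ _).2 le_rfl)
  intro a ih b hb
  exact hs b fun c hc => ih c (hc.trans_le ((lt_add_one_iff _ _).1 hb))

theorem IsRel.exists_least (P : M.N → Prop) [h : IsRel M P] (hP : ∃ a, P a) :
    ∃ a, P a ∧ ∀ b < a, ¬ P b := by
  by_contra! hc
  obtain ⟨a, ha⟩ := hP
  refine IsRel.strong_induction (fun a => ¬ P a) (fun a ih ha => ?_) a ha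
  obtain ⟨b, hb, hb'⟩ := hc a ha
  exact ih b hb hb'

/-- `Σ⁰₁` induction. -/
theorem IsRel.sigma_induction (Q : M.N → M.N → Prop) [h : IsRel M fun p : M.N × M.N => Q p.1 p.2]
    (h0 : ∃ b, Q 0 b) (hs : ∀ a, (∃ b, Q a b) → ∃ b, Q (a + 1) b) (a : M.N) : ∃ b, Q a b := by
  have := hM.out.induction (.ex 1 (.mem (pairTerm (.var 0) (.var 1)) 0)) ⟨1, _, .mem _ _, rfl⟩ 0
    (fun _ => 0) (fun _ => ⟨_, IsRel.pair_mem Q⟩)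
  have key : ∀ a b, (a + b) * (a + b) + a ∈ {c | ∃ x y, c = L2Structure.pair x y ∧ Q x y} ↔
      Q a b := by
    intro a b
    constructor
    · rintro ⟨x, y, h, h'⟩
      obtain ⟨rfl, rfl⟩ := pair_inj.1 h
      exact h'
    · exact fun h => ⟨a, b, rfl, h⟩
  simp only [Formula.Sat, Term.val, pairTerm, Function.update_self, ne_eq, zero_ne_one,
    not_false_eq_true, Function.update_of_ne, key] at this
  exact this h0 hs a

end Definability

/-! ### The space of true stages -/

section TrueStages

variable [hM : Fact M.IsModelRCA0]

/-- At stage `s` the number `n` enters the projection `{n | ∃ w, pair n w ∈ A}`: the stage is the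
pair of the least witness `w` for `n` and of `n`. The bounds on the quantifiers, here and below, are
automatic and make the relation `Δ⁰₁`. -/
def Enters (A : Set M.N) (s n : M.N) : Prop :=
  ∃ w, w ≤ s ∧ s = pair w n ∧ pair n w ∈ A ∧ ∀ w', w' < w → pair n w' ∉ A

/-- A number enters at stage `z`, and by stage `s` no smaller number has entered after it. -/
def TrueAt (A : Set M.N) (z s : M.N) : Prop :=
  ∃ m, m ≤ z ∧ Enters A z m ∧ ∀ t, t ≤ s → z < t → ∀ n, n ≤ t → Enters A t n → m < n

/-- The basic neighbourhood of `x` at stage `s`. It decreases with `s` to the set of `x` and all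
points above some true stage `z ≥ x`. -/
def trueNbhd (A : Set M.N) (x s : M.N) : Set M.N :=
  {y | y = x ∨ ∃ z, z < y ∧ x ≤ z ∧ TrueAt A z s}

variable {A : Set M.N}

section Definability

variable [hA : Fact (A ∈ M.sets)] {α : Type u} [Ctx M α] (t s r : α → M.N)
  [IsMap M t] [IsMap M s] [IsMap M r]

instance : IsRel M fun a => Enters A (t a) (s a) := by
  have : IsRel M fun p : M.N × M.N => Enters A p.1 p.2 := by unfold Enters; infer_instance
  exact IsRel.comp₂ (Enters A) t s

instance : IsRel M fun a => TrueAt A (t a) (s a) := by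
  have : IsRel M fun p : M.N × M.N => TrueAt A p.1 p.2 := by unfold TrueAt; infer_instance
  exact IsRel.comp₂ (TrueAt A) t s

instance : IsRel M fun a => r a ∈ trueNbhd A (t a) (s a) := by
  have : IsRel M fun p : (M.N × M.N) × M.N => p.2 ∈ trueNbhd A p.1.1 p.1.2 := by
    unfold trueNbhd; simp only [Set.mem_ofPred_eq]; infer_instance
  exact IsRel.comp₃ (fun x y z => z ∈ trueNbhd A x y) t s r

end Definability

theorem Enters.le {s n : M.N} (h : Enters A s n) : n ≤ s := by
  obtain ⟨w, -, rfl, -⟩ := h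
  exact le_pair_right w n

theorem Enters.unique_stage {s s' n : M.N} (h : Enters A s n) (h' : Enters A s' n) : s = s' := by
  obtain ⟨w, -, rfl, hw, hmin⟩ := h
  obtain ⟨w', -, rfl, hw', hmin'⟩ := h'
  have h1 : ¬ w < w' := fun h => hmin' _ h hw
  have h2 : ¬ w' < w := fun h => hmin _ h hw'
  rw [le_antisymm (not_lt.1 h2) (not_lt.1 h1)]

theorem exists_enters_iff [hA : Fact (A ∈ M.sets)] (n : M.N) :
    (∃ s, Enters A s n) ↔ ∃ w, pair n w ∈ A := by
  constructor
  · rintro ⟨s, w, -, -, h, -⟩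
    exact ⟨w, h⟩
  · intro h
    obtain ⟨w, hw, hmin⟩ := IsRel.exists_least (fun w => pair n w ∈ A) h
    exact ⟨pair w n, w, le_pair_left _ _, rfl, hw, hmin⟩

theorem TrueAt.anti {z s s' : M.N} (h : TrueAt A z s') (hs : s ≤ s') : TrueAt A z s := by
  obtain ⟨m, hm, h1, h2⟩ := h
  exact ⟨m, hm, h1, fun t ht => h2 t (ht.trans hs)⟩

theorem self_mem_trueNbhd (x s : M.N) : x ∈ trueNbhd A x s := Or.inl rfl

theorem le_of_mem_trueNbhd {x s y : M.N} (h : y ∈ trueNbhd A x s) : x ≤ y := by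
  rcases h with rfl | ⟨z, h1, h2, -⟩
  · rfl
  · exact h2.trans h1.le

theorem trueNbhd_subset {x y s s' : M.N} (h : y ∈ trueNbhd A x s) (hs : s ≤ s') :
    trueNbhd A y s' ⊆ trueNbhd A x s := by
  intro p hp
  rcases h with rfl | ⟨z, h1, h2, h3⟩
  · rcases hp with rfl | ⟨z, h1, h2, h3⟩
    · exact Or.inl rfl
    · exact Or.inr ⟨z, h1, h2, h3.anti hs⟩
  · exact Or.inr ⟨z, h1.trans_le (le_of_mem_trueNbhd hp), h2, h3⟩

/-- If numbers enter at arbitrarily late stages, then there are arbitrarily late true stages: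
otherwise, by `Σ⁰₁` induction, ever smaller numbers would enter. -/
theorem exists_true_stage [hA : Fact (A ∈ M.sets)] (x : M.N)
    (hx : ∃ t, x ≤ t ∧ ∃ n, Enters A t n) : ∃ z, x ≤ z ∧ ∀ s, TrueAt A z s := by
  by_contra! hc
  obtain ⟨t₀, ht₀, n₀, hn₀⟩ := hx
  obtain ⟨t, -, n, -, -, hn⟩ := IsRel.sigma_induction
    (fun b t => x ≤ t ∧ ∃ n, n ≤ t ∧ Enters A t n ∧ n + b ≤ n₀)
    ⟨t₀, ht₀, n₀, hn₀.le, hn₀, by simp⟩ (fun b ⟨t, ht, n, hnt, hn, hb⟩ => by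
      obtain ⟨s, hs⟩ := hc t ht
      simp only [TrueAt, not_exists, not_and, not_forall, not_lt] at hs
      obtain ⟨t', -, htt', n', -, hn', hle⟩ := hs n hnt hn
      refine ⟨t', ht.trans htt'.le, n', hn'.le, hn', ?_⟩
      have : n' < n := by
        refine lt_of_le_of_ne hle ?_
        rintro rfl
        exact htt'.ne (hn.unique_stage hn')
      have := (add_one_le_iff _ _).2 this
      grind) (n₀ + 1)
  have : n₀ < n₀ + 1 := (lt_add_one_iff _ _).2 le_rfl
  exact absurd (le_add_self.trans hn) (not_le.2 this)

/-- The space of all numbers, with the sets `trueNbhd A x s` as basis. The index of this set is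
`pair x s`, and indices that are not pairs stand for `∅`. Since `s ≤ pair x s`, the index
`pair x (m + n)` gives a neighbourhood of `x` at a stage late enough for the basic open sets with
indices `m` and `n`. -/
def trueStageSpace (A : Set M.N) (hA : A ∈ M.sets) : M.CSCSpace where
  X := Set.univ
  X_mem := univ_mem
  U := {c | ∃ y i, c = pair y i ∧ ∃ x, x ≤ i ∧ ∃ s, s ≤ i ∧ i = pair x s ∧ y ∈ trueNbhd A x s}
  U_mem := by
    have := Fact.mk hA
    exact IsRel.pair_mem (fun y i => ∃ x, x ≤ i ∧ ∃ s, s ≤ i ∧ i = pair x s ∧ y ∈ trueNbhd A x s)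
  sub _ := Set.subset_univ _
  cover x _ := ⟨pair x 0, x, pair x 0, rfl, x, le_pair_left _ _, 0, le_pair_right _ _, rfl,
    self_mem_trueNbhd _ _⟩
  k := {c | ∃ y r, c = pair y r ∧ ∃ z, z ≤ y ∧ ∃ n, n ≤ y ∧ y = pair z n ∧
    ∃ x, x ≤ z ∧ ∃ m, m ≤ z ∧ z = pair x m ∧ r = pair x (m + n)}
  k_fun := by
    constructor
    · exact IsRel.pair_mem (fun y r => ∃ z, z ≤ y ∧ ∃ n, n ≤ y ∧ y = pair z n ∧
        ∃ x, x ≤ z ∧ ∃ m, m ≤ z ∧ z = pair x m ∧ r = pair x (m + n))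
    · rintro _ ⟨_, r, rfl, z, -, n, -, rfl, x, -, m, -, rfl, rfl⟩
      exact ⟨_, ⟨x, trivial, m, n, rfl⟩, _, trivial, rfl⟩
    · rintro _ ⟨x, -, m, n, rfl⟩
      refine ⟨pair x (m + n), ⟨_, _, rfl, _, le_pair_left _ _, n, le_pair_right _ _, rfl, x,
        le_pair_left _ _, m, le_pair_right _ _, rfl, rfl⟩, ?_⟩
      rintro r ⟨_, r', h, z, -, n', -, rfl, x', -, m', -, rfl, rfl⟩
      simp only [pair_inj] at h
      obtain ⟨⟨⟨rfl, rfl⟩, rfl⟩, rfl⟩ := h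
      rfl
  k_spec := by
    rintro p - i j r ⟨_, r', h, z, -, n', -, rfl, x', -, m', -, rfl, rfl⟩
    simp only [pair_inj] at h
    obtain ⟨⟨⟨rfl, rfl⟩, rfl⟩, rfl⟩ := h
    rintro ⟨⟨_, _, h, x, -, s, -, rfl, hx⟩, ⟨_, _, h', y, -, t, -, rfl, hy⟩⟩
    obtain ⟨rfl, rfl⟩ := pair_inj.1 h
    obtain ⟨rfl, rfl⟩ := pair_inj.1 h'
    refine ⟨⟨_, _, rfl, _, le_pair_left _ _, _, le_pair_right _ _, rfl, self_mem_trueNbhd _ _⟩, ?_⟩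
    rintro q ⟨_, _, h, p', -, s', -, rfl, hp⟩
    simp only [pair_inj] at h
    obtain ⟨rfl, rfl, rfl⟩ := h
    exact ⟨⟨_, _, rfl, _, le_pair_left _ _, _, le_pair_right _ _, rfl,
        trueNbhd_subset hy ((le_pair_right _ _).trans le_add_self) hp⟩,
      ⟨_, _, rfl, _, le_pair_left _ _, _, le_pair_right _ _, rfl,
        trueNbhd_subset hx ((le_pair_right _ _).trans le_self_add) hp⟩⟩

theorem trueStageSpace_basis_pair (hA : A ∈ M.sets) (x s : M.N) :
    (trueStageSpace A hA).basis (pair x s) = trueNbhd A x s := by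
  ext y
  constructor
  · rintro ⟨_, _, h, x', -, s', -, rfl, hx⟩
    simp only [pair_inj] at h
    obtain ⟨rfl, rfl, rfl⟩ := h
    exact hx
  · exact fun h => ⟨_, _, rfl, x, le_pair_left _ _, s, le_pair_right _ _, rfl, h⟩

theorem trueStageSpace_basis (hA : A ∈ M.sets) {i y : M.N}
    (h : y ∈ (trueStageSpace A hA).basis i) :
    ∃ x s, (trueStageSpace A hA).basis i = trueNbhd A x s := by
  obtain ⟨_, _, h, x, -, s, -, rfl, -⟩ := h
  obtain ⟨-, rfl⟩ := pair_inj.1 h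
  exact ⟨x, s, trueStageSpace_basis_pair hA x s⟩

theorem isInf_iff {Y : Set M.N} : IsInf Y ↔ ∀ b, ∃ a ∈ Y, b ≤ a := by
  simp [IsInf, IsFin]

/-- In an infinite subspace `Y` no point `x` is common to all nonempty basic open sets, since the
neighbourhoods of a larger point do not contain `x`. -/
theorem trueStageSpace_no_common_point (hA : A ∈ M.sets) {Y : Set M.N} (hY : IsInf Y) {x : M.N}
    (h : ∀ i, (restrict (trueStageSpace A hA).basis Y i).Nonempty →
      x ∈ restrict (trueStageSpace A hA).basis Y i) : False := by
  obtain ⟨y, hy, hxy⟩ := isInf_iff.1 hY (x + 1)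
  have := h (pair y 0) ⟨y, by rw [trueStageSpace_basis_pair]; exact self_mem_trueNbhd _ _, hy⟩
  simp only [restrict, trueStageSpace_basis_pair] at this
  exact absurd (le_of_mem_trueNbhd this.1) (not_le.2 ((add_one_le_iff _ _).1 hxy))

theorem not_indiscrete_trueStageSpace (hA : A ∈ M.sets) {Y : Set M.N} (hY : IsInf Y) :
    ¬ Indiscrete Y (restrict (trueStageSpace A hA).basis Y) := by
  rintro ⟨h, -⟩
  obtain ⟨x, hx, -⟩ := isInf_iff.1 hY 0
  refine trueStageSpace_no_common_point hA hY (x := x) fun i hi => ?_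
  rcases h i with h | h
  · exact (hi.ne_empty h).elim
  · rwa [h]

theorem not_initialSegment_trueStageSpace (hA : A ∈ M.sets) {Y : Set M.N} (hY : IsInf Y) :
    ¬ InitialSegmentTopology Y (restrict (trueStageSpace A hA).basis Y) := by
  rintro ⟨H, hH, h, -⟩
  obtain ⟨x, hx, -⟩ := hH.total 0 trivial
  have hxY : x ∈ Y := by
    obtain ⟨_, -, b, hb, h⟩ := hH.sub _ hx
    rwa [(pair_inj.1 h).2]
  refine trueStageSpace_no_common_point hA hY (x := x) fun i hi => ?_
  rcases h i with h | h | ⟨j, h⟩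
  · exact (hi.ne_empty h).elim
  · rwa [h]
  · rw [h]
    exact ⟨0, (Le_iff_le _ _).2 zero_le, hx⟩

theorem not_t1_trueStageSpace [hA : Fact (A ∈ M.sets)] {Y : Set M.N} (hY : IsInf Y)
    (hc : ∀ x, ∃ t, x ≤ t ∧ ∃ n, Enters A t n) :
    ¬ T1 Y (restrict (trueStageSpace A hA.out).basis Y) := by
  intro h
  obtain ⟨x, hx, -⟩ := isInf_iff.1 hY 0
  obtain ⟨z, hz, hz'⟩ := exists_true_stage x (hc x)
  obtain ⟨y, hy, hzy⟩ := isInf_iff.1 hY (z + 1)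
  rw [add_one_le_iff] at hzy
  obtain ⟨i, -, ⟨⟨hxi, -⟩, -⟩, -, hyi⟩ := h x hx y hy (hz.trans_lt hzy).ne
  obtain ⟨x', s, hi⟩ := trueStageSpace_basis hA.out hxi
  rw [hi] at hxi
  refine hyi ⟨?_, hy⟩
  rw [hi]
  exact trueNbhd_subset hxi le_rfl (Or.inr ⟨z, hzy, hz, hz' s⟩)

/-- A function `N → Y` of the structure, given by its graph, as a function on `M.N`. -/
theorem IsFun.exists_fun {F X Y : Set M.N} (h : IsFun F X Y) (hX : X = Set.univ) :
    ∃ f : M.N → M.N, IsMap M f ∧ (∀ a, f a ∈ Y) ∧ ∀ a b, pair a b ∈ F ↔ b = f a := by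
  subst hX
  choose f hf hf' using fun a => h.total a trivial
  have key : ∀ a b, pair a b ∈ F ↔ b = f a :=
    fun a b => ⟨hf' a b, by rintro rfl; exact hf a⟩
  refine ⟨f, ⟨?_⟩, fun a => ?_, key⟩
  · convert h.mem using 1
    ext c
    constructor
    · rintro ⟨a, rfl⟩
      exact hf a
    · intro hc
      obtain ⟨a, -, b, -, rfl⟩ := h.sub c hc
      exact ⟨a, by rw [(key a b).1 hc]; rfl⟩
  · obtain ⟨_, -, b, hb, h⟩ := h.sub _ (hf a)
    rwa [(pair_inj.1 h).2]

/-- In an enumeration `h` which induces the final segment topology, a true stage (relative to any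
given stage) separates `h i` from `h (i + 1)`; hence only numbers `≥ i` enter from stage `h i` on.
The bound `t₀` on the stages allows an induction on a `Δ⁰₁` statement. -/
theorem le_of_enters_of_finalSeg [hA : Fact (A ∈ M.sets)] {Y H : Set M.N} {h : M.N → M.N}
    (hh : IsMap M h) (hhY : ∀ i, h i ∈ Y) (hH : IsBij H Set.univ Y)
    (hHh : ∀ a b, pair a b ∈ H ↔ b = h a)
    (hB : ∀ n, restrict (trueStageSpace A hA.out).basis Y n = ∅ ∨
      restrict (trueStageSpace A hA.out).basis Y n = Y ∨
      ∃ j, restrict (trueStageSpace A hA.out).basis Y n = finalSeg H j)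
    (t₀ i : M.N) : ∀ t, t ≤ t₀ → h i ≤ t → ∀ n, n ≤ t → Enters A t n → i ≤ n := by
  have hinj : Function.Injective h := fun a b hab => by
    obtain ⟨_, -, huniq⟩ := hH.bij (h a) (hhY a)
    rw [huniq a ((hHh _ _).2 rfl), huniq b ((hHh _ _).2 hab)]
  have hnext : ∀ i s, h (i + 1) ∈ trueNbhd A (h i) s := by
    intro i s
    have hi : h i ∈ restrict (trueStageSpace A hA.out).basis Y (pair (h i) s) :=
      ⟨by rw [trueStageSpace_basis_pair]; exact self_mem_trueNbhd _ _, hhY i⟩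
    have : h (i + 1) ∈ restrict (trueStageSpace A hA.out).basis Y (pair (h i) s) := by
      rcases hB (pair (h i) s) with h' | h' | ⟨j, h'⟩
      · rw [h'] at hi
        exact hi.elim
      · rw [h']
        exact hhY _
      · rw [h'] at hi ⊢
        obtain ⟨i', hji, hi⟩ := hi
        obtain rfl := hinj ((hHh _ _).1 hi)
        exact ⟨i + 1, (Le_iff_le _ _).2 (((Le_iff_le _ _).1 hji).trans le_self_add),
          (hHh _ _).2 rfl⟩
    rw [← trueStageSpace_basis_pair hA.out]
    exact this.1
  have hh' {α : Type u} [Ctx M α] (t : α → M.N) [IsMap M t] : IsMap M fun a => h (t a) :=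
    IsMap.comp h t
  refine IsRel.induction
    (fun i => ∀ t, t ≤ t₀ → h i ≤ t → ∀ n, n ≤ t → Enters A t n → i ≤ n) ?_ ?_ i
  · exact fun _ _ _ _ _ _ => zero_le
  · intro i ih t ht hit n _ hn
    -- a separating stage that is true relative to `t` enters some `m ≥ i`, and then `m < n`
    rcases hnext i t with h' | ⟨z, hz, hiz, m, hm, hzm, hz'⟩
    · have := (lt_add_one_iff i i).2 le_rfl
      exact absurd (hinj h') this.ne'
    · have h1 := ih z (hz.le.trans (hit.trans ht)) hiz m hm hzm
      have h2 := hz' t le_rfl (hz.trans_le hit) n hn.le hn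
      exact (add_one_le_iff _ _).2 (h1.trans_lt h2)

/-- `wGS` implies that the structure is closed under projections. -/
theorem SatWGS.proj_mem (hW : M.SatWGS) {A : Set M.N} (hA : A ∈ M.sets) :
    {n | ∃ w, pair n w ∈ A} ∈ M.sets := by
  have := Fact.mk hA
  by_cases hc : ∀ x, ∃ t, x ≤ t ∧ ∃ n, Enters A t n
  swap
  · -- nothing enters from some stage `x` on
    push Not at hc
    obtain ⟨x, hx⟩ := hc
    convert IsRel.setOf_mem (M := M) (fun n => ∃ t, t < x ∧ Enters A t n) using 3 with n
    rw [← exists_enters_iff]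
    exact ⟨fun ⟨s, hs⟩ => ⟨s, not_le.1 fun h => hx s h n hs, hs⟩, fun ⟨s, _, hs⟩ => ⟨s, hs⟩⟩
  obtain ⟨Y, hYM, -, hY, h | h | ⟨H, hH, hB, -⟩ | h⟩ := hW (trueStageSpace A hA)
    (isInf_iff.2 fun b => ⟨b, trivial, le_rfl⟩)
  · exact (not_indiscrete_trueStageSpace hA hY h).elim
  · exact (not_initialSegment_trueStageSpace hA hY h).elim
  · obtain ⟨h, hh, hhY, hHh⟩ := hH.toIsFun.exists_fun rfl
    have key := le_of_enters_of_finalSeg hh hhY hH hHh hB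
    have : IsMap M fun n => h (n + 1) := IsMap.comp h fun n => n + 1
    convert IsRel.setOf_mem (M := M) (fun n => ∃ t, t < h (n + 1) ∧ Enters A t n) using 3 with n
    rw [← exists_enters_iff]
    refine ⟨fun ⟨s, hs⟩ => ⟨s, not_le.1 fun h' => ?_, hs⟩, fun ⟨s, _, hs⟩ => ⟨s, hs⟩⟩
    exact absurd (key s (n + 1) s le_rfl h' n hs.le hs) (not_le.2 ((lt_add_one_iff _ _).2 le_rfl))
  · exact (not_t1_trueStageSpace hY hc h).elim

end TrueStages

/-! ### Closure under projections and arithmetical comprehension -/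

section Arithmetical

variable [hM : Fact M.IsModelRCA0]

theorem IsRel.ex_of_proj_mem
    (hproj : ∀ A ∈ M.sets, {a : M.N | ∃ b, pair a b ∈ A} ∈ M.sets) {α : Type u} [Ctx M α]
    (P : α → M.N → Prop) [hP : IsRel M fun p : α × M.N => P p.1 p.2] :
    IsRel M fun a => ∃ b, P a b := by
  constructor
  convert hproj _ hP.mem using 1
  ext c
  constructor
  · rintro ⟨a, ⟨b, hb⟩, rfl⟩
    exact ⟨b, (a, b), hb, rfl⟩
  · rintro ⟨b, ⟨⟨a, b'⟩, hb, h'⟩⟩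
    obtain ⟨rfl, rfl⟩ := pair_inj.1 h'
    exact ⟨a, ⟨_, hb⟩, rfl⟩

theorem isMap_termVal {α : Type u} [Ctx M α] (t : Term) (v : α → ℕ → M.N)
    (hv : ∀ i, IsMap M fun a => v a i) : IsMap M fun a => t.val M (v a) := by
  induction t with
  | var i => exact hv i
  | zero => exact IsMap.const (0 : M.N)
  | one => exact IsMap.const (1 : M.N)
  | add s t hs ht => exact IsMap.add (fun a => s.val M (v a)) fun a => t.val M (v a)
  | mul s t hs ht => exact IsMap.mul (fun a => s.val M (v a)) fun a => t.val M (v a)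

/-- Satisfaction of an arithmetical formula under an assignment that depends on a tuple. -/
theorem isRel_formulaSat (hproj : ∀ A ∈ M.sets, {a : M.N | ∃ b, pair a b ∈ A} ∈ M.sets)
    (φ : Formula) (hφ : φ.IsArithmetical) (V : ℕ → M.sets) :
    ∀ {α : Type u} [Ctx M α] (v : α → ℕ → M.N), (∀ i, IsMap M fun a => v a i) →
      IsRel M fun a => φ.Sat M (v a) V := by
  have hupd : ∀ {α : Type u} [Ctx M α] (v : α → ℕ → M.N), (∀ i, IsMap M fun a => v a i) →
      ∀ i j, IsMap M fun p : α × M.N => Function.update (v p.1) i p.2 j := by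
    intro α _ v hv i j
    rcases eq_or_ne j i with rfl | hj
    · simp only [Function.update_self]
      infer_instance
    · simp only [Function.update_of_ne hj]
      exact IsMap.weaken _ (h := hv j)
  induction φ with
  | eq s t =>
    intro α _ v hv
    have h1 := isMap_termVal s v hv
    have h2 := isMap_termVal t v hv
    exact IsRel.eq _ _
  | lt s t =>
    intro α _ v hv
    have h1 := isMap_termVal s v hv
    have h2 := isMap_termVal t v hv
    exact IsRel.lt _ _
  | mem s X =>
    intro α _ v hv
    have h1 := isMap_termVal s v hv
    exact IsRel.mem_of_mem (V X).2 _
  | not φ ih =>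
    intro α _ v hv
    exact IsRel.not _ (h := ih hφ v hv)
  | and φ ψ ih ih' =>
    intro α _ v hv
    exact IsRel.and _ _ (h := ih hφ.1 v hv) (h' := ih' hφ.2 v hv)
  | or φ ψ ih ih' =>
    intro α _ v hv
    exact IsRel.or _ _ (h := ih hφ.1 v hv) (h' := ih' hφ.2 v hv)
  | imp φ ψ ih ih' =>
    intro α _ v hv
    exact IsRel.imp _ _ (h := ih hφ.1 v hv) (h' := ih' hφ.2 v hv)
  | all i φ ih =>
    intro α _ v hv
    have := IsRel.not _ (h := ih hφ (fun p : α × M.N => Function.update (v p.1) i p.2)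
      (hupd v hv i))
    have := IsRel.not _ (h := IsRel.ex_of_proj_mem hproj
      fun a b => ¬ φ.Sat M (Function.update (v a) i b) V)
    simpa [Formula.Sat] using this
  | ex i φ ih =>
    intro α _ v hv
    have := ih hφ (fun p : α × M.N => Function.update (v p.1) i p.2) (hupd v hv i)
    exact IsRel.ex_of_proj_mem hproj fun a b => φ.Sat M (Function.update (v a) i b) V
  | allSet => exact hφ.elim
  | exSet => exact hφ.elim

theorem isModelACA0_of_proj_mem
    (hproj : ∀ A ∈ M.sets, {a : M.N | ∃ b, pair a b ∈ A} ∈ M.sets) : M.IsModelACA0 where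
  basic := hM.out.basic
  induction A hA h0 hs := by
    have := Fact.mk hA
    exact IsRel.induction (fun a => a ∈ A) h0 hs
  comprehension φ hφ i v V := by
    have := isRel_formulaSat hproj φ hφ V (fun a : M.N => Function.update v i a) fun j => by
      rcases eq_or_ne j i with rfl | hj
      · simp only [Function.update_self]
        infer_instance
      · simp only [Function.update_of_ne hj]
        infer_instance
    exact IsRel.setOf_mem _

omit hM in
theorem IsModelACA0.proj_mem (h : M.IsModelACA0) {A : Set M.N} (hA : A ∈ M.sets) :
    {a : M.N | ∃ b, pair a b ∈ A} ∈ M.sets := by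
  have := h.comprehension (.ex 1 (.mem (pairTerm (.var 0) (.var 1)) 0)) trivial 0
    (fun _ => 0) fun _ => ⟨A, hA⟩
  simpa [Formula.Sat, Term.val, pairTerm, pair] using this

end Arithmetical

/-! ### Finite sets and recursion in models of arithmetical comprehension -/

section ACA

variable [hM : Fact M.IsModelRCA0] [hACA : Fact M.IsModelACA0]

instance IsRel.ex {α : Type u} [Ctx M α] (P : α → M.N → Prop)
    [hP : IsRel M fun p : α × M.N => P p.1 p.2] : IsRel M fun a => ∃ b, P a b :=
  IsRel.ex_of_proj_mem (fun _ => hACA.out.proj_mem) P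

instance IsRel.all {α : Type u} [Ctx M α] (P : α → M.N → Prop)
    [hP : IsRel M fun p : α × M.N => P p.1 p.2] : IsRel M fun a => ∀ b, P a b := by
  have : IsRel M fun a => ¬ ∃ b, ¬ P a b := inferInstance
  simpa using this

instance IsRel.dvd {α : Type u} [Ctx M α] (t s : α → M.N) [IsMap M t] [IsMap M s] :
    IsRel M fun a => t a ∣ s a := by
  have : IsRel M fun p : M.N × M.N => p.1 ∣ p.2 := by
    simp only [dvd_def]; infer_instance
  exact IsRel.comp₂ (fun x y => x ∣ y) t s

/-- The finite set coded by `u` and `d`: by the Chinese remainder idea, `x` is a member if the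
modulus `1 + (x + 1) d` divides `u`. -/
def codeSet (u d : M.N) : Set M.N := {x | 1 + (x + 1) * d ∣ u}

instance {α : Type u} [Ctx M α] (t s r : α → M.N) [IsMap M t] [IsMap M s] [IsMap M r] :
    IsRel M fun a => t a ∈ codeSet (s a) (r a) := by
  have : IsRel M fun p : (M.N × M.N) × M.N => p.1.1 ∈ codeSet p.1.2 p.2 := by
    simp only [codeSet, Set.mem_ofPred_eq]; infer_instance
  exact IsRel.comp₃ (fun x y z => x ∈ codeSet y z) t s r

instance (u d : M.N) : IsRel M fun x => x ∈ codeSet u d := by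
  unfold codeSet; simp only [Set.mem_ofPred_eq]; infer_instance

theorem exists_common_multiple (b : M.N) : ∃ d : M.N, d ≠ 0 ∧ ∀ i, i ≤ b → 0 < i → i ∣ d := by
  refine IsRel.induction (fun b : M.N => ∃ d : M.N, d ≠ 0 ∧ ∀ i, i ≤ b → 0 < i → i ∣ d) ?_ ?_ b
  · exact ⟨1, one_ne_zero, fun i hi hi' => absurd hi (not_le.2 hi')⟩
  · rintro b ⟨d, hd, h⟩
    refine ⟨d * (b + 1), mul_ne_zero hd (by simp), fun i hi hi' => ?_⟩
    rcases hi.lt_or_eq with hi | rfl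
    · exact (h i ((lt_add_one_iff _ _).1 hi) hi').mul_right _
    · exact dvd_mul_left _ _

omit hACA in
theorem dvd_of_dvd_add {a b c : M.N} (h : a ∣ b) (h' : a ∣ b + c) : a ∣ c := by
  obtain ⟨x, rfl⟩ := h
  obtain ⟨y, hy⟩ := h'
  rcases le_total x y with hxy | hxy
  · obtain ⟨z, rfl⟩ := exists_add_of_le hxy
    exact ⟨z, add_left_cancel (a := a * x) (by rw [hy, mul_add])⟩
  · obtain ⟨z, rfl⟩ := exists_add_of_le hxy
    have : a * z + c = 0 := add_left_cancel (a := a * y) (by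
      rw [add_zero, ← add_assoc, ← mul_add, hy])
    rw [(add_eq_zero.1 this).2]
    exact dvd_zero _

omit hACA in
/-- The moduli of two distinct numbers below `b` are relatively prime. -/
theorem modulus_coprime {b d i j k : M.N} (hd : ∀ i, i ≤ b → 0 < i → i ∣ d) (hi : i < b)
    (hj : j < b) (hij : i ≠ j) (h : 1 + (i + 1) * d ∣ k * (1 + (j + 1) * d)) :
    1 + (i + 1) * d ∣ k := by
  have h1 : ∃ e, e ≤ b ∧ 0 < e ∧ 1 + (i + 1) * d ∣ k * e * d := by
    rcases hij.lt_or_gt with hij | hij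
    · obtain ⟨e, rfl⟩ := exists_add_of_le hij.le
      refine ⟨e, le_add_self.trans hj.le, pos_iff_ne_zero.2 ?_, ?_⟩
      · rintro rfl
        simp at hij
      · refine dvd_of_dvd_add (b := k * (1 + (i + 1) * d)) (dvd_mul_left _ _) ?_
        convert h using 1
        ring
    · obtain ⟨e, rfl⟩ := exists_add_of_le hij.le
      refine ⟨e, le_add_self.trans hi.le, pos_iff_ne_zero.2 ?_, ?_⟩
      · rintro rfl
        simp at hij
      · refine dvd_of_dvd_add h ?_
        rw [show k * (1 + (j + 1) * d) + k * e * d = k * (1 + (j + e + 1) * d) by ring]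
        exact dvd_mul_left _ _
  obtain ⟨e, heb, he, h1⟩ := h1
  obtain ⟨c, hc⟩ := hd e heb he
  have h2 : 1 + (i + 1) * d ∣ k * d * d := by
    have := h1.mul_right c
    rwa [show k * e * d * c = k * (e * c) * d by ring, ← hc] at this
  -- `(i + 1) d ≡ -1` modulo `1 + (i + 1) d`, so each factor `d` can be removed
  have h3 : ∀ l, 1 + (i + 1) * d ∣ l * d → 1 + (i + 1) * d ∣ l := fun l hl =>
    dvd_of_dvd_add (hl.mul_right (i + 1)) (by
      rw [show l * d * (i + 1) + l = l * (1 + (i + 1) * d) by ring]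
      exact dvd_mul_left _ _)
  exact h3 _ (h3 _ h2)

theorem exists_code {A : Set M.N} (hA : A ∈ M.sets) (b : M.N) :
    ∃ u d : M.N, ∀ x < b, x ∈ codeSet u d ↔ x ∈ A := by
  have := Fact.mk hA
  obtain ⟨d, hd0, hd⟩ := exists_common_multiple b
  have key : ∀ n, n ≤ b → ∃ u : M.N, (∀ x, x < n → x ∈ A → 1 + (x + 1) * d ∣ u) ∧
      ∀ x, x < b → (x ∈ A ∧ x < n) ∨ ∀ k, 1 + (x + 1) * d ∣ k * u → 1 + (x + 1) * d ∣ k := by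
    refine IsRel.induction (fun n => n ≤ b → ∃ u : M.N,
      (∀ x, x < n → x ∈ A → 1 + (x + 1) * d ∣ u) ∧
      ∀ x, x < b → (x ∈ A ∧ x < n) ∨ ∀ k, 1 + (x + 1) * d ∣ k * u → 1 + (x + 1) * d ∣ k) ?_ ?_
    · exact fun _ => ⟨1, by simp, fun x _ => Or.inr fun k hk => by rwa [mul_one] at hk⟩
    · intro n ih hn
      have hnb := (add_one_le_iff _ _).1 hn
      obtain ⟨u, h1, h2⟩ := ih hnb.le
      by_cases hnA : n ∈ A
      · refine ⟨u * (1 + (n + 1) * d), fun x hx hxA => ?_, fun x hx => ?_⟩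
        · rcases ((lt_add_one_iff _ _).1 hx).lt_or_eq with hx | rfl
          · exact (h1 x hx hxA).mul_right _
          · exact dvd_mul_left _ _
        · rcases eq_or_ne x n with rfl | hxn
          · exact Or.inl ⟨hnA, (lt_add_one_iff _ _).2 le_rfl⟩
          · refine (h2 x hx).imp (fun h => ⟨h.1, (lt_add_one_iff _ _).2 h.2.le⟩) fun h k hk => ?_
            rw [← mul_assoc] at hk
            exact h k (modulus_coprime hd hx hnb hxn hk)
      · refine ⟨u, fun x hx hxA => ?_, fun x hx => ?_⟩
        · rcases ((lt_add_one_iff _ _).1 hx).lt_or_eq with hx | rfl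
          · exact h1 x hx hxA
          · exact (hnA hxA).elim
        · exact (h2 x hx).imp (fun h => ⟨h.1, (lt_add_one_iff _ _).2 h.2.le⟩) id
  obtain ⟨u, h1, h2⟩ := key b le_rfl
  refine ⟨u, d, fun x hx => ⟨fun h => ?_, h1 x hx⟩⟩
  rcases h2 x hx with h' | h'
  · exact h'.1
  · obtain ⟨c, hc⟩ := h' 1 (by rwa [one_mul])
    have h3 : c ≠ 0 := by rintro rfl; simp at hc
    have h4 : 1 + (x + 1) * d ≤ 1 := by
      conv_rhs => rw [hc]
      refine le_mul_of_one_le_right zero_le ?_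
      rw [← zero_add (1 : M.N), add_one_le_iff]
      exact pos_iff_ne_zero.2 h3
    have h5 : (x + 1) * d = 0 := by simpa using h4
    simp [hd0] at h5

/-- The set coded by `u` and `d` satisfies the course-of-values recursion for `Φ` below `n`. -/
def IsCourse (Φ : M.N → Set M.N → Prop) (n u d : M.N) : Prop :=
  ∀ x, x < n → (x ∈ codeSet u d ↔ Φ x {y | y < x ∧ y ∈ codeSet u d})

/-- Course-of-values recursion: membership of `x` is determined by the smaller members. -/
theorem exists_recursion (Φ : M.N → Set M.N → Prop)
    (hΦ : IsRel M fun p : (M.N × M.N) × M.N => Φ p.1.1 {y | y < p.1.1 ∧ y ∈ codeSet p.1.2 p.2}) :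
    ∃ S ∈ M.sets, ∀ x, x ∈ S ↔ Φ x {y | y < x ∧ y ∈ S} := by
  have hΦ' {α : Type u} [Ctx M α] (t s r : α → M.N) [IsMap M t] [IsMap M s] [IsMap M r] :
      IsRel M fun a => Φ (t a) {y | y < t a ∧ y ∈ codeSet (s a) (r a)} :=
    IsRel.comp₃ (fun x u d => Φ x {y | y < x ∧ y ∈ codeSet u d}) t s r
  have hGood : IsRel M fun p : (M.N × M.N) × M.N => IsCourse Φ p.1.1 p.1.2 p.2 := by
    unfold IsCourse; infer_instance
  have hGood' {α : Type u} [Ctx M α] (t s r : α → M.N) [IsMap M t] [IsMap M s] [IsMap M r] :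
      IsRel M fun a => IsCourse Φ (t a) (s a) (r a) := IsRel.comp₃ (IsCourse Φ) t s r
  have congr : ∀ {x : M.N} {A B : Set M.N}, (∀ y, y < x → (y ∈ A ↔ y ∈ B)) →
      {y | y < x ∧ y ∈ A} = {y | y < x ∧ y ∈ B} := by
    intro x A B h
    ext y
    exact and_congr_right fun hy => h y hy
  have uniq : ∀ {n u d n' u' d'}, IsCourse Φ n u d → IsCourse Φ n' u' d' →
      ∀ x, x < n → x < n' → (x ∈ codeSet u d ↔ x ∈ codeSet u' d') := by
    intro n u d n' u' d' h h' x
    refine IsRel.strong_induction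
      (fun x => x < n → x < n' → (x ∈ codeSet u d ↔ x ∈ codeSet u' d')) ?_ x
    intro x ih hx hx'
    rw [h x hx, h' x hx', congr fun y hy => ih y hy (hy.trans hx) (hy.trans hx')]
  have exist : ∀ n, ∃ u d, IsCourse Φ n u d := by
    refine IsRel.induction (fun n => ∃ u d, IsCourse Φ n u d) ?_ ?_
    · exact ⟨0, 0, fun x hx => absurd hx (not_lt.2 zero_le)⟩
    · rintro n ⟨u, d, h⟩
      obtain ⟨u', d', h'⟩ := exists_code (IsRel.setOf_mem (M := M) fun x =>
        (x < n ∧ x ∈ codeSet u d) ∨ (x = n ∧ Φ n {y | y < n ∧ y ∈ codeSet u d})) (n + 1)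
      have hlt : ∀ y, y < n → (y ∈ codeSet u' d' ↔ y ∈ codeSet u d) := by
        intro y hy
        rw [h' y ((lt_add_one_iff _ _).2 hy.le)]
        simp [hy, hy.ne]
      refine ⟨u', d', fun x hx => ?_⟩
      have hxn := (lt_add_one_iff _ _).1 hx
      rw [congr fun y hy => hlt y (hy.trans_le hxn)]
      rcases hxn.lt_or_eq with hxn | rfl
      · rw [hlt x hxn, h x hxn]
      · rw [h' x hx]
        simp
  have hSM : IsRel M fun x : M.N => ∃ u d, IsCourse Φ (x + 1) u d ∧ x ∈ codeSet u d := by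
    infer_instance
  refine ⟨{x | ∃ u d, IsCourse Φ (x + 1) u d ∧ x ∈ codeSet u d}, hSM.setOf_mem, fun x => ?_⟩
  obtain ⟨u, d, h⟩ := exist (x + 1)
  have hS : ∀ y, y < x + 1 →
      (y ∈ {x | ∃ u d, IsCourse Φ (x + 1) u d ∧ x ∈ codeSet u d} ↔ y ∈ codeSet u d) := by
    intro y hy
    have hy1 : y < y + 1 := (lt_add_one_iff _ _).2 le_rfl
    constructor
    · rintro ⟨u', d', h', hy'⟩
      exact (uniq h' h y hy1 hy).1 hy'
    · intro hy'
      exact ⟨u, d, fun z hz => h z (hz.trans_le ((add_one_le_iff _ _).2 hy)), hy'⟩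
  have hx1 : x < x + 1 := (lt_add_one_iff _ _).2 le_rfl
  rw [hS x hx1, h x hx1, congr fun y hy => hS y (hy.trans hx1)]

end ACA

/-! ### Ramsey's theorem for pairs and enumerations -/

section ACA

variable [hM : Fact M.IsModelRCA0] [hACA : Fact M.IsModelACA0]

omit hACA in
theorem not_isInf_iff {Y : Set M.N} : ¬ IsInf Y ↔ ∃ b, ∀ a ∈ Y, a < b := by
  simp [isInf_iff]

omit hACA in
theorem lt_add_one (n : M.N) : n < n + 1 := (lt_add_one_iff n n).2 le_rfl

/-- If every point of the infinite set `Z` is related to a bounded part of `Z` only, then a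
greedily chosen subset of `Z` is infinite and contains no related pairs. -/
theorem exists_infinite_unrelated {Z : Set M.N} (hZ : Z ∈ M.sets) (hinf : IsInf Z)
    (R : M.N → M.N → Prop) (hR : IsRel M fun p : M.N × M.N => R p.1 p.2)
    (hb : ∀ x ∈ Z, ∃ m, ∀ z ∈ Z, m ≤ z → ¬ R x z) :
    ∃ Y ∈ M.sets, Y ⊆ Z ∧ IsInf Y ∧ ∀ x ∈ Y, ∀ y ∈ Y, x < y → ¬ R x y := by
  have := Fact.mk hZ
  have hR' {α : Type u} [Ctx M α] (t s : α → M.N) [IsMap M t] [IsMap M s] :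
    IsRel M fun a => R (t a) (s a) := IsRel.comp₂ R t s
  obtain ⟨T, hT, hTrec⟩ := exists_recursion (M := M) (fun x A => x ∈ Z ∧ ∀ y, y ∈ A → ¬ R y x)
    (by simp only [Set.mem_ofPred_eq]; infer_instance)
  have := Fact.mk hT
  refine ⟨T, hT, fun x hx => ((hTrec x).1 hx).1, ?_,
    fun x hx y hy hxy => ((hTrec y).1 hy).2 x ⟨hxy, hx⟩⟩
  by_contra hfin
  obtain ⟨b, hbT⟩ := not_isInf_iff.1 hfin
  have key : ∀ n, ∃ m, ∀ y, y < n → y ∈ T → ∀ z, z ∈ Z → m ≤ z → ¬ R y z := by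
    refine IsRel.induction (fun n => ∃ m, ∀ y, y < n → y ∈ T → ∀ z, z ∈ Z → m ≤ z → ¬ R y z) ?_ ?_
    · exact ⟨0, fun y hy => absurd hy (not_lt.2 zero_le)⟩
    · rintro n ⟨m, hm⟩
      by_cases hn : n ∈ T
      · obtain ⟨m', hm'⟩ := hb n ((hTrec n).1 hn).1
        refine ⟨max m m', fun y hy hyT z hz hmz => ?_⟩
        rcases ((lt_add_one_iff _ _).1 hy).lt_or_eq with hy | rfl
        · exact hm y hy hyT z hz ((le_max_left _ _).trans hmz)
        · exact hm' z hz ((le_max_right _ _).trans hmz)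
      · refine ⟨m, fun y hy hyT z hz hmz => ?_⟩
        rcases ((lt_add_one_iff _ _).1 hy).lt_or_eq with hy | rfl
        · exact hm y hy hyT z hz hmz
        · exact (hn hyT).elim
  obtain ⟨m, hm⟩ := key b
  obtain ⟨z, hz, hmz⟩ := isInf_iff.1 hinf (max m b)
  refine absurd (hbT z ((hTrec z).2 ⟨hz, fun y hy => ?_⟩)) (not_lt.2 ((le_max_right _ _).trans hmz))
  exact hm y (hbT y hy.2) hy.2 z hz ((le_max_left _ _).trans hmz)

/-- Ramsey's theorem for pairs and two colours. A set `S` of pairwise related numbers is chosen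
greedily, such that infinitely many numbers remain related to all of its elements. If it is finite,
then among those remaining numbers each is related to a bounded set only. -/
theorem ramsey {Z : Set M.N} (hZ : Z ∈ M.sets) (hinf : IsInf Z)
    (R : M.N → M.N → Prop) (hR : IsRel M fun p : M.N × M.N => R p.1 p.2) :
    ∃ Y ∈ M.sets, Y ⊆ Z ∧ IsInf Y ∧
      ((∀ x ∈ Y, ∀ y ∈ Y, x < y → R x y) ∨ ∀ x ∈ Y, ∀ y ∈ Y, x < y → ¬ R x y) := by
  have := Fact.mk hZ
  have hR' {α : Type u} [Ctx M α] (t s : α → M.N) [IsMap M t] [IsMap M s] :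
    IsRel M fun a => R (t a) (s a) := IsRel.comp₂ R t s
  obtain ⟨S, hS, hSrec⟩ := exists_recursion (M := M) (fun x A => x ∈ Z ∧ (∀ y, y ∈ A → R y x) ∧
    ∀ b, ∃ z, z ∈ Z ∧ (∀ y, y ∈ A → R y z) ∧ R x z ∧ b ≤ z)
    (by simp only [Set.mem_ofPred_eq]; infer_instance)
  have := Fact.mk hS
  by_cases hSinf : IsInf S
  · exact ⟨S, hS, fun x hx => ((hSrec x).1 hx).1, hSinf,
      Or.inl fun x hx y hy hxy => ((hSrec y).1 hy).2.1 x ⟨hxy, hx⟩⟩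
  -- the choices made below `n` leave infinitely many candidates
  have inv : ∀ n b, ∃ z, z ∈ Z ∧ (∀ y, y < n → y ∈ S → R y z) ∧ b ≤ z := by
    refine IsRel.induction (fun n => ∀ b, ∃ z, z ∈ Z ∧ (∀ y, y < n → y ∈ S → R y z) ∧ b ≤ z) ?_ ?_
    · intro b
      obtain ⟨z, hz, hbz⟩ := isInf_iff.1 hinf b
      exact ⟨z, hz, fun y hy => absurd hy (not_lt.2 zero_le), hbz⟩
    · intro n ih b
      by_cases hn : n ∈ S
      · obtain ⟨z, hz, h1, h2, h3⟩ := ((hSrec n).1 hn).2.2 b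
        refine ⟨z, hz, fun y hy hyS => ?_, h3⟩
        rcases ((lt_add_one_iff _ _).1 hy).lt_or_eq with hy | rfl
        · exact h1 y ⟨hy, hyS⟩
        · exact h2
      · obtain ⟨z, hz, h1, h2⟩ := ih b
        refine ⟨z, hz, fun y hy hyS => ?_, h2⟩
        rcases ((lt_add_one_iff _ _).1 hy).lt_or_eq with hy | rfl
        · exact h1 y hy hyS
        · exact (hn hyS).elim
  obtain ⟨b, hb⟩ := not_isInf_iff.1 hSinf
  have hrest : IsInf {z | z ∈ Z ∧ (∀ y, y ∈ S → R y z) ∧ b ≤ z} := by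
    rw [isInf_iff]
    intro c
    obtain ⟨z, hz, h1, h2⟩ := inv b (max b c)
    exact ⟨z, ⟨hz, fun y hy => h1 y (hb y hy) hy, (le_max_left _ _).trans h2⟩,
      (le_max_right _ _).trans h2⟩
  have hbd : ∀ x ∈ {z | z ∈ Z ∧ (∀ y, y ∈ S → R y z) ∧ b ≤ z}, ∃ m,
      ∀ z ∈ {z | z ∈ Z ∧ (∀ y, y ∈ S → R y z) ∧ b ≤ z}, m ≤ z → ¬ R x z := by
    rintro x ⟨hx, hxS, hbx⟩
    by_contra! hc
    refine absurd (hb x ((hSrec x).2 ⟨hx, fun y hy => hxS y hy.2, fun m => ?_⟩)) (not_lt.2 hbx)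
    obtain ⟨z, ⟨hz, hzS, -⟩, hmz, hxz⟩ := hc m
    exact ⟨z, hz, fun y hy => hzS y hy.2, hxz, hmz⟩
  obtain ⟨Y, hY, hYZ, hYinf, hYR⟩ := exists_infinite_unrelated (IsRel.setOf_mem _) hrest R hR hbd
  exact ⟨Y, hY, fun x hx => (hYZ hx).1, hYinf, Or.inr hYR⟩

/-- The increasing enumeration of an infinite set. -/
theorem exists_enumeration {Y : Set M.N} (hY : Y ∈ M.sets) (hinf : IsInf Y) :
    ∃ h : M.N → M.N, IsMap M h ∧ (∀ i, h i ∈ Y) ∧ StrictMono h ∧ ∀ y ∈ Y, ∃ i, h i = y := by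
  have := Fact.mk hY
  -- `pair i x` enters the graph if `x` is the least element of `Y` and `i = 0`, or `x` is the next
  -- element of `Y` after the value at `i - 1`
  obtain ⟨S, hS, hSrec⟩ := exists_recursion (M := M) (fun c A => ∃ i x, c = pair i x ∧ x ∈ Y ∧
    ((i = 0 ∧ ∀ z, z ∈ Y → x ≤ z) ∨ ∃ j y, i = j + 1 ∧ pair j y ∈ A ∧ y < x ∧
      ∀ z, z ∈ Y → y < z → x ≤ z))
    (by simp only [Set.mem_ofPred_eq]; infer_instance)
  have := Fact.mk hS
  have hmono : ∀ {i j x y : M.N}, i < j → x < y → pair i x < pair j y := by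
    intro i j x y hij hxy
    have h1 : i + x ≤ j + y := add_le_add hij.le hxy.le
    exact add_lt_add_of_le_of_lt (mul_le_mul' h1 h1) hij
  have hzero : ∀ x, pair 0 x ∈ S ↔ x ∈ Y ∧ ∀ z, z ∈ Y → x ≤ z := by
    intro x
    rw [hSrec]
    constructor
    · rintro ⟨i, x', h, hx, h' | ⟨j, y, hj, -⟩⟩
      · obtain ⟨rfl, rfl⟩ := pair_inj.1 h
        exact ⟨hx, h'.2⟩
      · obtain ⟨rfl, rfl⟩ := pair_inj.1 h
        exact (hM.out.basic.succ_ne_zero _ hj.symm).elim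
    · rintro ⟨hx, h⟩
      exact ⟨0, x, rfl, hx, Or.inl ⟨rfl, h⟩⟩
  have hsucc : ∀ j x, pair (j + 1) x ∈ S ↔ x ∈ Y ∧ ∃ y, pair j y ∈ S ∧ y < x ∧
      ∀ z, z ∈ Y → y < z → x ≤ z := by
    intro j x
    rw [hSrec]
    constructor
    · rintro ⟨i, x', h, hx, h' | ⟨j', y, hj, hyS, hyx, hz⟩⟩
      · obtain ⟨rfl, rfl⟩ := pair_inj.1 h
        exact (hM.out.basic.succ_ne_zero _ h'.1).elim
      · obtain ⟨rfl, rfl⟩ := pair_inj.1 h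
        obtain rfl := add_right_cancel hj
        exact ⟨hx, y, hyS.2, hyx, hz⟩
    · rintro ⟨hx, y, hyS, hyx, hz⟩
      exact ⟨j + 1, x, rfl, hx, Or.inr ⟨j, y, rfl, ⟨hmono (lt_add_one j) hyx, hyS⟩, hyx, hz⟩⟩
  have hfun : ∀ i, ∃ x, pair i x ∈ S ∧ ∀ y, pair i y ∈ S → y = x := by
    refine IsRel.induction (fun i => ∃ x, pair i x ∈ S ∧ ∀ y, pair i y ∈ S → y = x) ?_ ?_
    · obtain ⟨y, hy, -⟩ := isInf_iff.1 hinf 0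
      obtain ⟨x, hx, hmin⟩ := IsRel.exists_least (M := M) (fun x => x ∈ Y) ⟨y, hy⟩
      refine ⟨x, (hzero x).2 ⟨hx, fun z hz => not_lt.1 fun h => hmin z h hz⟩, fun y hy => ?_⟩
      obtain ⟨hy, h⟩ := (hzero y).1 hy
      exact le_antisymm (h x hx) (not_lt.1 fun h => hmin y h hy)
    · rintro i ⟨x, hx, huniq⟩
      obtain ⟨y, hy, hxy⟩ := isInf_iff.1 hinf (x + 1)
      obtain ⟨x', ⟨hx', hxx'⟩, hmin⟩ := IsRel.exists_least (M := M) (fun y => y ∈ Y ∧ x < y)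
        ⟨y, hy, (add_one_le_iff _ _).1 hxy⟩
      have hmin' : ∀ z, z ∈ Y → x < z → x' ≤ z := fun z hz hxz =>
        not_lt.1 fun h => hmin z h ⟨hz, hxz⟩
      refine ⟨x', (hsucc i x').2 ⟨hx', x, hx, hxx', hmin'⟩, fun y hy => ?_⟩
      obtain ⟨hy, z, hz, hzy, h⟩ := (hsucc i y).1 hy
      obtain rfl := huniq z hz
      exact le_antisymm (h x' hx' hxx') (hmin' y hy hzy)
  choose h hhS huniq using hfun
  have hY' : ∀ i, h i ∈ Y := by
    intro i
    obtain ⟨i, x, hi, hx, -⟩ := (hSrec _).1 (hhS i)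
    obtain ⟨rfl, rfl⟩ := pair_inj.1 hi
    exact hx
  have hmap : IsMap M h := by
    have hgraph : IsRel M fun p : M.N × M.N => pair p.1 p.2 ∈ S := by infer_instance
    have : IsRel M fun p : M.N × M.N => p.2 = h p.1 := by
      convert hgraph using 2 with p
      exact ⟨fun hp => hp ▸ hhS _, fun hp => huniq _ _ hp⟩
    exact IsMap.of_graph h
  have hmap' {α : Type u} [Ctx M α] (t : α → M.N) [IsMap M t] : IsMap M fun a => h (t a) :=
    IsMap.comp h t
  have hnext : ∀ i, h i < h (i + 1) ∧ ∀ z, z ∈ Y → h i < z → h (i + 1) ≤ z := by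
    intro i
    obtain ⟨-, y, hy, h1, h2⟩ := (hsucc _ _).1 (hhS (i + 1))
    obtain rfl := huniq _ _ hy
    exact ⟨h1, h2⟩
  have hstrict : StrictMono h := by
    intro i j
    refine IsRel.induction (fun j => i < j → h i < h j) ?_ ?_ j
    · exact fun h => absurd h (not_lt.2 zero_le)
    · intro j ih hij
      rcases ((lt_add_one_iff _ _).1 hij).lt_or_eq with hij | rfl
      · exact (ih hij).trans (hnext j).1
      · exact (hnext i).1
  have hle : ∀ i, i ≤ h i := by
    refine IsRel.induction (fun i => i ≤ h i) zero_le fun i ih => ?_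
    exact (add_one_le_iff _ _).2 (ih.trans_lt (hnext i).1)
  refine ⟨h, hmap, hY', hstrict, fun y hy => ?_⟩
  obtain ⟨i, hi, hmin⟩ := IsRel.exists_least (M := M) (fun i => y ≤ h i) ⟨y, hle y⟩
  refine ⟨i, le_antisymm ?_ hi⟩
  rcases hM.out.eq_zero_or_succ i with rfl | ⟨j, rfl⟩
  · exact ((hzero _).1 (hhS 0)).2 y hy
  · exact (hnext j).2 y hy (not_le.1 (hmin j (lt_add_one j)))

end ACA

/-! ### The Ginsburg–Sands theorem from arithmetical comprehension -/

section GinsburgSands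

variable [hM : Fact M.IsModelRCA0]

instance {α : Type u} [Ctx M α] (A : M.CSCSpace) (t s : α → M.N) [IsMap M t] [IsMap M s] :
    IsRel M fun a => t a ∈ A.basis (s a) :=
  IsRel.mem_of_mem A.U_mem fun a => pair (t a) (s a)

instance (A : M.CSCSpace) (n : M.N) : IsRel M fun x => x ∈ A.basis n :=
  IsRel.mem_of_mem A.U_mem fun x => pair x n

omit hM in
theorem CSCSpace.exists_basis_subset_inter (A : M.CSCSpace) {x m n : M.N} (hm : x ∈ A.basis m)
    (hn : x ∈ A.basis n) : ∃ r, x ∈ A.basis r ∧ A.basis r ⊆ A.basis m ∧ A.basis r ⊆ A.basis n := by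
  have hx := A.sub m hm
  obtain ⟨r, hr, -⟩ := A.k_fun.total (pair (pair x m) n) ⟨x, hx, m, n, rfl⟩
  obtain ⟨h1, h2⟩ := A.k_spec x hx m n r hr ⟨hm, hn⟩
  exact ⟨r, h1, fun _ h => (h2 h).2, fun _ h => (h2 h).1⟩

/-- `x` is in the closure of `{y}`: every basic open set that contains `x` contains `y`. -/
def CSCSpace.MemClosure (A : M.CSCSpace) (x y : M.N) : Prop := ∀ n, x ∈ A.basis n → y ∈ A.basis n

variable [hACA : Fact M.IsModelACA0]

/-- In a `T₁` subspace, basic neighbourhoods may be shrunk to avoid any bounded set of other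
points. -/
theorem CSCSpace.exists_basis_avoiding (A : M.CSCSpace) {Y : Set M.N} (hY : Y ∈ M.sets)
    (hT : T1 Y (restrict A.basis Y)) {x n : M.N} (hx : x ∈ Y) (hn : x ∈ A.basis n) (b : M.N) :
    ∃ r, x ∈ A.basis r ∧ A.basis r ⊆ A.basis n ∧ ∀ y ∈ Y, y < b → y ∈ A.basis r → y = x := by
  have := Fact.mk hY
  refine IsRel.induction (fun b => ∃ r, x ∈ A.basis r ∧ (∀ z, z ∈ A.basis r → z ∈ A.basis n) ∧
    ∀ y, y ∈ Y → y < b → y ∈ A.basis r → y = x) ?_ ?_ b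
  · exact ⟨n, hn, fun _ => id, fun y _ hy => absurd hy (not_lt.2 zero_le)⟩
  · rintro b ⟨r, hxr, hrn, hr⟩
    by_cases hb : b ∈ Y ∧ b ≠ x
    · obtain ⟨m, -, ⟨⟨hxm, -⟩, -⟩, -, hbm⟩ := hT x hx b hb.1 hb.2.symm
      obtain ⟨s, hxs, hsr, hsm⟩ := A.exists_basis_subset_inter hxr hxm
      refine ⟨s, hxs, fun z hz => hrn z (hsr hz), fun y hy hyb hys => ?_⟩
      rcases ((lt_add_one_iff _ _).1 hyb).lt_or_eq with hyb | rfl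
      · exact hr y hy hyb (hsr hys)
      · exact (hbm ⟨hsm hys, hy⟩).elim
    · refine ⟨r, hxr, hrn, fun y hy hyb hys => ?_⟩
      rcases ((lt_add_one_iff _ _).1 hyb).lt_or_eq with hyb | rfl
      · exact hr y hy hyb hys
      · exact by_contra fun h => hb ⟨hy, h⟩

omit hM hACA in
theorem T1.mono {B : M.N → Set M.N} {Y Z : Set M.N} (h : T1 Y (restrict B Y)) (hZ : Z ⊆ Y) :
    T1 Z (restrict B Z) := by
  intro x hx y hy hxy
  obtain ⟨m, n, ⟨⟨h1, -⟩, h2⟩, ⟨h3, -⟩, h4⟩ := h x (hZ hx) y (hZ hy) hxy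
  exact ⟨m, n, ⟨⟨h1, hx⟩, fun h => h2 ⟨h.1, hZ hx⟩⟩, ⟨h3, hy⟩, fun h => h4 ⟨h.1, hZ hy⟩⟩

/-- A `T₁` subspace in which every basic open set is empty or has bounded complement has the
cofinite topology. -/
theorem CSCSpace.cofiniteTopology (A : M.CSCSpace) {Z : Set M.N} (hZ : Z ∈ M.sets) (hZX : Z ⊆ A.X)
    (hinf : IsInf Z) (hT : T1 Z (restrict A.basis Z))
    (hB : ∀ n, restrict A.basis Z n = ∅ ∨ IsFin (Z \ restrict A.basis Z n)) :
    CofiniteTopology Z (restrict A.basis Z) := by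
  refine ⟨hB, fun Z' hZ' hsub ⟨b, hb⟩ => ?_⟩
  have := Fact.mk hZ
  have := Fact.mk hZ'
  have key : ∀ x ∈ Z', ∃ n, x ∈ A.basis n ∧ ∀ z, z ∈ Z → z ∈ A.basis n → z ∈ Z' := by
    intro x hx
    obtain ⟨n, hn⟩ := A.cover x (hZX (hsub hx))
    obtain ⟨r, hxr, -, hr⟩ := A.exists_basis_avoiding hZ hT (hsub hx) hn b
    refine ⟨r, hxr, fun z hz hzr => by_contra fun hz' => ?_⟩
    obtain rfl := hr z hz (hb z ⟨hz, hz'⟩) hzr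
    exact hz' hx
  obtain ⟨x₀, hx₀, hx₀'⟩ : ∃ x, x ∈ Z' ∧ x ∈ Z := by
    obtain ⟨x, hx, hbx⟩ := isInf_iff.1 hinf b
    exact ⟨x, by_contra fun h => absurd (hb x ⟨hx, h⟩) (not_lt.2 hbx), hx⟩
  obtain ⟨n₀, hn₀, hn₀'⟩ := key x₀ hx₀
  -- the code enumerates all basic open sets whose trace on `Z` is contained in `Z'`
  have hrel : IsRel M fun p : M.N × M.N => ((∀ z, z ∈ Z → z ∈ A.basis p.1 → z ∈ Z') ∧ p.2 = p.1) ∨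
      ((¬ ∀ z, z ∈ Z → z ∈ A.basis p.1 → z ∈ Z') ∧ p.2 = n₀) := by infer_instance
  refine ⟨_, ⟨IsRel.pair_mem (fun i n => ((∀ z, z ∈ Z → z ∈ A.basis i → z ∈ Z') ∧ n = i) ∨
      ((¬ ∀ z, z ∈ Z → z ∈ A.basis i → z ∈ Z') ∧ n = n₀)), ?_, ?_⟩, ?_⟩
  · rintro _ ⟨i, n, rfl, -⟩
    exact ⟨i, trivial, n, trivial, rfl⟩
  · intro i _
    by_cases hi : ∀ z, z ∈ Z → z ∈ A.basis i → z ∈ Z'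
    · refine ⟨i, ⟨i, i, rfl, Or.inl ⟨hi, rfl⟩⟩, ?_⟩
      rintro y ⟨i', y', h, h'⟩
      obtain ⟨rfl, rfl⟩ := pair_inj.1 h
      exact (h'.resolve_right fun h => h.1 hi).2
    · refine ⟨n₀, ⟨i, n₀, rfl, Or.inr ⟨hi, rfl⟩⟩, ?_⟩
      rintro y ⟨i', y', h, h'⟩
      obtain ⟨rfl, rfl⟩ := pair_inj.1 h
      exact (h'.resolve_left fun h => hi h.1).2
  · ext x
    constructor
    · rintro ⟨n, ⟨i, i', n', h, h'⟩, hx, hxZ⟩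
      obtain ⟨rfl, rfl⟩ := pair_inj.1 h
      rcases h' with ⟨h', rfl⟩ | ⟨-, rfl⟩
      · exact h' x hxZ hx
      · exact hn₀' x hxZ hx
    · intro hx
      obtain ⟨n, hn, hn'⟩ := key x hx
      exact ⟨n, ⟨n, n, n, rfl, Or.inl ⟨hn', rfl⟩⟩, hn, hsub hx⟩

/-- Suppose that each index `n` in an infinite set `S` has a point `x` of the subspace in `U n` and
outside of all `U m` with `m < n` in `S`. The least such points form an infinite discrete
subspace. -/
theorem CSCSpace.exists_discrete (A : M.CSCSpace) {Y S : Set M.N} (hY : Y ∈ M.sets)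
    (hT : T1 Y (restrict A.basis Y)) (hS : S ∈ M.sets) (hSinf : IsInf S)
    (h : ∀ n ∈ S, ∃ x, x ∈ Y ∧ x ∈ A.basis n ∧ ∀ m, m < n → m ∈ S → x ∉ A.basis m) :
    ∃ D ∈ M.sets, D ⊆ Y ∧ IsInf D ∧ Discrete D (restrict A.basis D) := by
  have := Fact.mk hY
  have := Fact.mk hS
  obtain ⟨P, hPdef⟩ : ∃ P : M.N → M.N → Prop, P = fun n x => n ∈ S ∧
      (x ∈ Y ∧ x ∈ A.basis n ∧ ∀ m, m < n → m ∈ S → x ∉ A.basis m) ∧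
      ∀ y, y < x → ¬ (y ∈ Y ∧ y ∈ A.basis n ∧ ∀ m, m < n → m ∈ S → y ∉ A.basis m) := ⟨_, rfl⟩
  have hP : IsRel M fun p : M.N × M.N => P p.1 p.2 := by
    rw [hPdef]; infer_instance
  have hP' {α : Type u} [Ctx M α] (t s : α → M.N) [IsMap M t] [IsMap M s] :
    IsRel M fun a => P (t a) (s a) := IsRel.comp₂ P t s
  have hex : ∀ n ∈ S, ∃ x, P n x := by
    intro n hn
    have hrel : IsRel M fun x => x ∈ Y ∧ x ∈ A.basis n ∧ ∀ m, m < n → m ∈ S → x ∉ A.basis m := by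
      infer_instance
    obtain ⟨x, hx, hmin⟩ := hrel.exists_least _ (h n hn)
    exact ⟨x, by rw [hPdef]; exact ⟨hn, hx, hmin⟩⟩
  have huniq : ∀ {n x y}, P n x → P n y → x = y := by
    intro n x y hx hy
    rw [hPdef] at hx hy
    exact le_antisymm (not_lt.1 fun h => hx.2.2 y h hy.2.1) (not_lt.1 fun h => hy.2.2 x h hx.2.1)
  have hsep : ∀ {m n x y}, P m x → P n y → m < n → y ∉ A.basis m := by
    intro m n x y hx hy hmn
    rw [hPdef] at hx hy
    exact hy.2.1.2.2 m hmn hx.1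
  have hPn : ∀ {n x}, P n x → n ∈ S ∧ x ∈ Y ∧ x ∈ A.basis n := by
    intro n x hx
    rw [hPdef] at hx
    exact ⟨hx.1, hx.2.1.1, hx.2.1.2.1⟩
  -- only finitely many of the points are below a given bound
  have hlarge : ∀ b, ∃ m, ∀ n, m ≤ n → ∀ x, P n x → b ≤ x := by
    refine IsRel.induction (fun b => ∃ m, ∀ n, m ≤ n → ∀ x, P n x → b ≤ x) ?_ ?_
    · exact ⟨0, fun _ _ _ _ => zero_le⟩
    · rintro b ⟨m, hm⟩
      by_cases hb : ∃ n, P n b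
      · obtain ⟨n, hn⟩ := hb
        refine ⟨max m (n + 1), fun n' hn' x hx => (add_one_le_iff _ _).2 ?_⟩
        refine lt_of_le_of_ne (hm n' ((le_max_left _ _).trans hn') x hx) ?_
        rintro rfl
        exact hsep hn hx ((add_one_le_iff _ _).1 ((le_max_right _ _).trans hn')) (hPn hn).2.2
      · refine ⟨m, fun n hn x hx => (add_one_le_iff _ _).2 (lt_of_le_of_ne (hm n hn x hx) ?_)⟩
        rintro rfl
        exact hb ⟨n, hx⟩
  have hbound : ∀ n, ∃ c, ∀ m, m < n → ∀ x, P m x → x < c := by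
    refine IsRel.induction (fun n => ∃ c, ∀ m, m < n → ∀ x, P m x → x < c) ?_ ?_
    · exact ⟨0, fun m hm => absurd hm (not_lt.2 zero_le)⟩
    · rintro n ⟨c, hc⟩
      by_cases hn : ∃ x, P n x
      · obtain ⟨x, hx⟩ := hn
        refine ⟨max c (x + 1), fun m hm y hy => ?_⟩
        rcases ((lt_add_one_iff _ _).1 hm).lt_or_eq with hm | rfl
        · exact (hc m hm y hy).trans_le (le_max_left _ _)
        · rw [huniq hy hx]
          exact (lt_add_one x).trans_le (le_max_right _ _)
      · refine ⟨c, fun m hm y hy => ?_⟩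
        rcases ((lt_add_one_iff _ _).1 hm).lt_or_eq with hm | rfl
        · exact hc m hm y hy
        · exact (hn ⟨y, hy⟩).elim
  have hDY : {x | ∃ n, P n x} ⊆ Y := fun x ⟨n, hn⟩ => (hPn hn).2.1
  refine ⟨{x | ∃ n, P n x}, IsRel.setOf_mem _, hDY, isInf_iff.2 fun b => ?_, ?_⟩
  · obtain ⟨m, hm⟩ := hlarge b
    obtain ⟨n, hn, hmn⟩ := isInf_iff.1 hSinf m
    obtain ⟨x, hx⟩ := hex n hn
    exact ⟨x, ⟨n, hx⟩, hm n hmn x hx⟩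
  · rintro x ⟨n, hn⟩
    obtain ⟨c, hc⟩ := hbound (n + 1)
    obtain ⟨-, hxY, hxn⟩ := hPn hn
    obtain ⟨r, hxr, hrn, hr⟩ := A.exists_basis_avoiding hY hT hxY hxn c
    refine ⟨r, Set.eq_singleton_iff_unique_mem.2 ⟨⟨hxr, n, hn⟩, ?_⟩⟩
    rintro y ⟨hyr, m, hm⟩
    refine hr y (hPn hm).2.1 (hc m ?_ y hm) hyr
    exact (lt_add_one_iff _ _).2 (not_lt.1 fun h => hsep hn hm h (hrn hyr))

/-- An infinite `T₁` subspace has an infinite subspace that is discrete or has the cofinite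
topology. Indices of basic open sets are chosen greedily, as long as the basic open set meets what
remains of the subspace and infinitely many points stay outside of it. -/
theorem CSCSpace.exists_discrete_or_cofinite (A : M.CSCSpace) {Y : Set M.N} (hY : Y ∈ M.sets)
    (hYX : Y ⊆ A.X) (hinf : IsInf Y) (hT : T1 Y (restrict A.basis Y)) :
    ∃ Z ∈ M.sets, Z ⊆ Y ∧ IsInf Z ∧
      (Discrete Z (restrict A.basis Z) ∨ CofiniteTopology Z (restrict A.basis Z)) := by
  have := Fact.mk hY
  obtain ⟨S, hS, hSrec⟩ := exists_recursion (M := M) (fun n C =>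
    (∃ x, x ∈ Y ∧ x ∈ A.basis n ∧ ∀ m, m ∈ C → x ∉ A.basis m) ∧
    ∀ b, ∃ x, x ∈ Y ∧ x ∉ A.basis n ∧ (∀ m, m ∈ C → x ∉ A.basis m) ∧ b ≤ x)
    (by simp only [Set.mem_ofPred_eq]; infer_instance)
  have := Fact.mk hS
  by_cases hSinf : IsInf S
  · obtain ⟨D, hD, hDY, hDinf, hDd⟩ := A.exists_discrete hY hT hS hSinf fun n hn => by
      obtain ⟨⟨x, hx, hxn, h⟩, -⟩ := (hSrec n).1 hn
      exact ⟨x, hx, hxn, fun m hm hmS => h m ⟨hm, hmS⟩⟩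
    exact ⟨D, hD, hDY, hDinf, Or.inl hDd⟩
  -- the sets discarded below `n` leave an infinite rest
  have inv : ∀ n b, ∃ z, z ∈ Y ∧ (∀ m, m < n → m ∈ S → z ∉ A.basis m) ∧ b ≤ z := by
    refine IsRel.induction
      (fun n => ∀ b, ∃ z, z ∈ Y ∧ (∀ m, m < n → m ∈ S → z ∉ A.basis m) ∧ b ≤ z) ?_ ?_
    · intro b
      obtain ⟨z, hz, hbz⟩ := isInf_iff.1 hinf b
      exact ⟨z, hz, fun m hm => absurd hm (not_lt.2 zero_le), hbz⟩
    · intro n ih b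
      by_cases hn : n ∈ S
      · obtain ⟨z, hz, h1, h2, h3⟩ := ((hSrec n).1 hn).2 b
        refine ⟨z, hz, fun m hm hmS => ?_, h3⟩
        rcases ((lt_add_one_iff _ _).1 hm).lt_or_eq with hm | rfl
        · exact h2 m ⟨hm, hmS⟩
        · exact h1
      · obtain ⟨z, hz, h1, h2⟩ := ih b
        refine ⟨z, hz, fun m hm hmS => ?_, h2⟩
        rcases ((lt_add_one_iff _ _).1 hm).lt_or_eq with hm | rfl
        · exact h1 m hm hmS
        · exact (hn hmS).elim
  obtain ⟨b, hb⟩ := not_isInf_iff.1 hSinf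
  have hZ : {z | z ∈ Y ∧ ∀ m, m ∈ S → z ∉ A.basis m} ∈ M.sets := IsRel.setOf_mem _
  have hZY : {z | z ∈ Y ∧ ∀ m, m ∈ S → z ∉ A.basis m} ⊆ Y := fun z hz => hz.1
  have hZinf : IsInf {z | z ∈ Y ∧ ∀ m, m ∈ S → z ∉ A.basis m} := isInf_iff.2 fun c => by
    obtain ⟨z, hz, h1, h2⟩ := inv b c
    exact ⟨z, ⟨hz, fun m hm => h1 m (hb m hm) hm⟩, h2⟩
  refine ⟨_, hZ, hZY, hZinf, Or.inr (A.cofiniteTopology hZ (hZY.trans hYX) hZinf (hT.mono hZY)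
    fun n => or_iff_not_imp_left.2 fun hne => by_contra fun hfin => ?_)⟩
  obtain ⟨x, hxn, hx⟩ := Set.nonempty_iff_ne_empty.2 hne
  refine hx.2 n ((hSrec n).2 ⟨⟨x, hx.1, hxn, fun m hm => hx.2 m hm.2⟩, fun c => ?_⟩) hxn
  obtain ⟨z, ⟨hz, hzn⟩, hcz⟩ := isInf_iff.1 hfin c
  exact ⟨z, hz.1, fun h => hzn ⟨h, hz⟩, fun m hm => hz.2 m hm.2, hcz⟩

omit hACA in
theorem isBij_graph {Y : Set M.N} {h : M.N → M.N} (hh : IsMap M h) (hY : ∀ i, h i ∈ Y)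
    (hmono : StrictMono h) (hsurj : ∀ y ∈ Y, ∃ i, h i = y) :
    IsBij {c | ∃ i x, c = pair i x ∧ x = h i} Set.univ Y where
  mem := by
    have := hh.graph
    exact IsRel.pair_mem fun i x => x = h i
  sub := by
    rintro _ ⟨i, x, rfl, rfl⟩
    exact ⟨i, trivial, h i, hY i, rfl⟩
  total i _ := by
    refine ⟨h i, ⟨i, _, rfl, rfl⟩, ?_⟩
    rintro y ⟨i', x, h', rfl⟩
    obtain ⟨rfl, rfl⟩ := pair_inj.1 h'
    rfl
  bij y hy := by
    obtain ⟨i, rfl⟩ := hsurj y hy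
    refine ⟨i, ⟨i, _, rfl, rfl⟩, ?_⟩
    rintro j ⟨j', x, h', rfl⟩
    obtain ⟨rfl, h'⟩ := pair_inj.1 h'
    exact hmono.injective h'.symm

omit hACA in
theorem mem_graph {h : M.N → M.N} {i x : M.N} :
    pair i x ∈ {c | ∃ i x, c = pair i x ∧ x = h i} ↔ x = h i := by
  constructor
  · rintro ⟨i', x', h', rfl⟩
    obtain ⟨rfl, rfl⟩ := pair_inj.1 h'
    rfl
  · exact fun h' => ⟨i, x, rfl, h'⟩

theorem CSCSpace.finalSegmentTopology (A : M.CSCSpace) {Y : Set M.N} (hY : Y ∈ M.sets)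
    (hYX : Y ⊆ A.X) (hinf : IsInf Y)
    (h1 : ∀ x ∈ Y, ∀ y ∈ Y, x < y → A.MemClosure x y)
    (h2 : ∀ x ∈ Y, ∀ y ∈ Y, x < y → ¬ A.MemClosure y x) :
    FinalSegmentTopology Y (restrict A.basis Y) := by
  obtain ⟨h, hh, hhY, hmono, hsurj⟩ := exists_enumeration hY hinf
  have hh' {α : Type u} [Ctx M α] (t : α → M.N) [IsMap M t] : IsMap M fun a => h (t a) :=
    IsMap.comp h t
  have hup : ∀ n i j, h i ∈ A.basis n → i ≤ j → h j ∈ A.basis n := by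
    intro n i j hi hij
    rcases hij.lt_or_eq with hij | rfl
    · exact h1 _ (hhY i) _ (hhY j) (hmono hij) n hi
    · exact hi
  have hseg : ∀ n j, h j ∈ A.basis n → (∀ i, i < j → h i ∉ A.basis n) →
      restrict A.basis Y n = finalSeg {c | ∃ i x, c = pair i x ∧ x = h i} j := by
    intro n j hj hlt
    ext x
    constructor
    · rintro ⟨hxn, hxY⟩
      obtain ⟨i, rfl⟩ := hsurj x hxY
      exact ⟨i, (Le_iff_le _ _).2 (not_lt.1 fun hi => hlt i hi hxn), mem_graph.2 rfl⟩
    · rintro ⟨i, hji, hx⟩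
      obtain rfl := mem_graph.1 hx
      exact ⟨hup n j i hj ((Le_iff_le _ _).1 hji), hhY i⟩
  refine ⟨_, isBij_graph hh hhY hmono hsurj, fun n => ?_, fun j => ?_⟩
  · rw [or_iff_not_imp_left]
    intro hne
    obtain ⟨x, hxn, hxY⟩ := Set.nonempty_iff_ne_empty.2 hne
    obtain ⟨i, rfl⟩ := hsurj x hxY
    have hrel : IsRel M fun i => h i ∈ A.basis n := by infer_instance
    obtain ⟨j, hj, hmin⟩ := hrel.exists_least _ ⟨i, hxn⟩
    exact Or.inr ⟨j, hseg n j hj hmin⟩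
  · rcases hM.out.eq_zero_or_succ j with rfl | ⟨i, rfl⟩
    · obtain ⟨n, hn⟩ := A.cover (h 0) (hYX (hhY 0))
      exact ⟨n, hseg n 0 hn fun i hi => absurd hi (not_lt.2 zero_le)⟩
    · have := h2 _ (hhY i) _ (hhY (i + 1)) (hmono (lt_add_one i))
      simp only [CSCSpace.MemClosure, not_forall] at this
      obtain ⟨n, hn, hn'⟩ := this
      exact ⟨n, hseg n _ hn fun k hk hk' => hn' (hup n k i hk' ((lt_add_one_iff _ _).1 hk))⟩

theorem CSCSpace.initialSegmentTopology (A : M.CSCSpace) {Y : Set M.N} (hY : Y ∈ M.sets)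
    (hinf : IsInf Y)
    (h1 : ∀ x ∈ Y, ∀ y ∈ Y, x < y → ¬ A.MemClosure x y)
    (h2 : ∀ x ∈ Y, ∀ y ∈ Y, x < y → A.MemClosure y x) :
    InitialSegmentTopology Y (restrict A.basis Y) := by
  obtain ⟨h, hh, hhY, hmono, hsurj⟩ := exists_enumeration hY hinf
  have hh' {α : Type u} [Ctx M α] (t : α → M.N) [IsMap M t] : IsMap M fun a => h (t a) :=
    IsMap.comp h t
  have hdown : ∀ n i j, h i ∈ A.basis n → j ≤ i → h j ∈ A.basis n := by
    intro n i j hi hij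
    rcases hij.lt_or_eq with hij | rfl
    · exact h2 _ (hhY j) _ (hhY i) (hmono hij) n hi
    · exact hi
  have hseg : ∀ n j, h j ∈ A.basis n → h (j + 1) ∉ A.basis n →
      restrict A.basis Y n = initSeg {c | ∃ i x, c = pair i x ∧ x = h i} j := by
    intro n j hj hlt
    ext x
    constructor
    · rintro ⟨hxn, hxY⟩
      obtain ⟨i, rfl⟩ := hsurj x hxY
      refine ⟨i, (Le_iff_le _ _).2 (not_lt.1 fun hi => hlt ?_), mem_graph.2 rfl⟩
      exact hdown n i _ hxn ((add_one_le_iff _ _).2 hi)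
    · rintro ⟨i, hji, hx⟩
      obtain rfl := mem_graph.1 hx
      exact ⟨hdown n j i hj ((Le_iff_le _ _).1 hji), hhY i⟩
  refine ⟨_, isBij_graph hh hhY hmono hsurj, fun n => ?_, fun j => ?_⟩
  · by_cases hall : ∃ i, h i ∉ A.basis n
    · have hrel : IsRel M fun i => h i ∉ A.basis n := by infer_instance
      obtain ⟨j, hj, hmin⟩ := hrel.exists_least _ hall
      rcases hM.out.eq_zero_or_succ j with rfl | ⟨i, rfl⟩
      · left
        refine Set.eq_empty_iff_forall_notMem.2 fun x ⟨hxn, hxY⟩ => hj ?_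
        obtain ⟨i, rfl⟩ := hsurj x hxY
        exact hdown n i 0 hxn zero_le
      · exact Or.inr (Or.inr ⟨i, hseg n i (not_not.1 (hmin i (lt_add_one i))) hj⟩)
    · push Not at hall
      refine Or.inr (Or.inl (Set.inter_eq_right.2 fun x hx => ?_))
      obtain ⟨i, rfl⟩ := hsurj x hx
      exact hall i
  · have := h1 _ (hhY j) _ (hhY (j + 1)) (hmono (lt_add_one j))
    simp only [CSCSpace.MemClosure, not_forall] at this
    obtain ⟨n, hn, hn'⟩ := this
    exact ⟨n, hseg n j hn hn'⟩

omit hACA in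
theorem CSCSpace.indiscrete (A : M.CSCSpace) {Y : Set M.N} (hYX : Y ⊆ A.X) (hinf : IsInf Y)
    (h1 : ∀ x ∈ Y, ∀ y ∈ Y, x < y → A.MemClosure x y)
    (h2 : ∀ x ∈ Y, ∀ y ∈ Y, x < y → A.MemClosure y x) : Indiscrete Y (restrict A.basis Y) := by
  have key : ∀ n, ∀ x ∈ Y, x ∈ A.basis n → restrict A.basis Y n = Y := by
    refine fun n x hx hxn => Set.inter_eq_right.2 fun y hy => ?_
    rcases lt_trichotomy x y with h | rfl | h
    · exact h1 x hx y hy h n hxn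
    · exact hxn
    · exact h2 y hy x hx h n hxn
  refine ⟨fun n => or_iff_not_imp_left.2 fun hne => ?_, ?_⟩
  · obtain ⟨x, hxn, hx⟩ := Set.nonempty_iff_ne_empty.2 hne
    exact key n x hx hxn
  · obtain ⟨x, hx, -⟩ := isInf_iff.1 hinf 0
    obtain ⟨n, hn⟩ := A.cover x (hYX hx)
    exact ⟨n, key n x hx hn⟩

omit hM hACA in
theorem CSCSpace.t1_of_not_memClosure (A : M.CSCSpace) {Y : Set M.N}
    (h : ∀ x ∈ Y, ∀ y ∈ Y, x ≠ y → ¬ A.MemClosure x y) : T1 Y (restrict A.basis Y) := by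
  intro x hx y hy hxy
  have h1 := h x hx y hy hxy
  have h2 := h y hy x hx hxy.symm
  simp only [CSCSpace.MemClosure, not_forall] at h1 h2
  obtain ⟨m, hm, hm'⟩ := h1
  obtain ⟨n, hn, hn'⟩ := h2
  exact ⟨m, n, ⟨⟨hm, hx⟩, fun h => hn' h.1⟩, ⟨hn, hy⟩, fun h => hm' h.1⟩

variable (M) in
theorem satGS_of_isModelACA0 : M.SatGS := by
  intro A hX
  have hsp : IsRel M fun p : M.N × M.N => A.MemClosure p.1 p.2 := by
    unfold CSCSpace.MemClosure; infer_instance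
  have hsp' : IsRel M fun p : M.N × M.N => A.MemClosure p.2 p.1 :=
    IsRel.comp₂ A.MemClosure (fun p : M.N × M.N => p.2) fun p => p.1
  obtain ⟨Y, hY, hYX, hYinf, h1⟩ := ramsey A.X_mem hX A.MemClosure hsp
  obtain ⟨Z, hZ, hZY, hZinf, h2⟩ := ramsey hY hYinf (fun x y => A.MemClosure y x) hsp'
  have hZX := hZY.trans hYX
  rcases h1 with h1 | h1 <;> rcases h2 with h2 | h2
  · exact ⟨Z, hZ, hZX, hZinf, Or.inl (A.indiscrete hZX hZinf
      (fun x hx y hy => h1 x (hZY hx) y (hZY hy)) h2)⟩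
  · exact ⟨Z, hZ, hZX, hZinf, Or.inr (Or.inr (Or.inl (A.finalSegmentTopology hZ hZX hZinf
      (fun x hx y hy => h1 x (hZY hx) y (hZY hy)) h2)))⟩
  · exact ⟨Z, hZ, hZX, hZinf, Or.inr (Or.inl (A.initialSegmentTopology hZ hZinf
      (fun x hx y hy => h1 x (hZY hx) y (hZY hy)) h2))⟩
  · have hT : T1 Z (restrict A.basis Z) := A.t1_of_not_memClosure fun x hx y hy hxy => by
      rcases hxy.lt_or_gt with h | h
      · exact h1 x (hZY hx) y (hZY hy) h
      · exact h2 y hy x hx h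
    obtain ⟨W, hW, hWZ, hWinf, h⟩ := A.exists_discrete_or_cofinite hZ hZX hZinf hT
    exact ⟨W, hW, hWZ.trans hZX, hWinf, Or.inr (Or.inr (Or.inr h))⟩

end GinsburgSands

/-! ### Discrete and cofinite topologies are `T₁` -/

section Separation

variable [hM : Fact M.IsModelRCA0]

omit hM in
theorem Discrete.t1 {Y : Set M.N} {B : M.N → Set M.N} (h : Discrete Y B) : T1 Y B := by
  intro x hx y hy hxy
  obtain ⟨m, hm⟩ := h x hx
  obtain ⟨n, hn⟩ := h y hy
  exact ⟨m, n, by simp [hm, hn, hxy], by simp [hm, hn, hxy.symm]⟩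

theorem CofiniteTopology.t1 {Y : Set M.N} {B : M.N → Set M.N} (hY : Y ∈ M.sets)
    (h : CofiniteTopology Y B) : T1 Y B := by
  have := Fact.mk hY
  have key : ∀ x ∈ Y, ∀ y ∈ Y, x ≠ y → ∃ m, x ∈ B m ∧ y ∉ B m := by
    intro x hx y hy hxy
    obtain ⟨O, -, hO⟩ := h.2 {z | z ∈ Y ∧ z ≠ y} (IsRel.setOf_mem _) (fun z hz => hz.1)
      ⟨y + 1, fun z hz => (lt_add_one_iff _ _).2 (le_of_eq (by_contra fun h => hz.2 ⟨hz.1, h⟩))⟩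
    have hxO : x ∈ openSet B O := by rw [hO]; exact ⟨hx, hxy⟩
    obtain ⟨m, hm, hxm⟩ := hxO
    refine ⟨m, hxm, fun hym => ?_⟩
    have hyO : y ∈ openSet B O := ⟨m, hm, hym⟩
    rw [hO] at hyO
    exact hyO.2 rfl
  intro x hx y hy hxy
  obtain ⟨m, h1, h2⟩ := key x hx y hy hxy
  obtain ⟨n, h3, h4⟩ := key y hy x hx hxy.symm
  exact ⟨m, n, ⟨h1, h4⟩, ⟨h3, h2⟩⟩

theorem SatGS.satWGS (h : M.SatGS) : M.SatWGS := by
  intro A hA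
  obtain ⟨Y, hY, hYX, hinf, h | h | h | h | h⟩ := h A hA
  · exact ⟨Y, hY, hYX, hinf, Or.inl h⟩
  · exact ⟨Y, hY, hYX, hinf, Or.inr (Or.inl h)⟩
  · exact ⟨Y, hY, hYX, hinf, Or.inr (Or.inr (Or.inl h))⟩
  · exact ⟨Y, hY, hYX, hinf, Or.inr (Or.inr (Or.inr h.t1))⟩
  · exact ⟨Y, hY, hYX, hinf, Or.inr (Or.inr (Or.inr (h.t1 hY)))⟩

end Separation

end SOA.L2Structure

theorem mainTheorem2 (M : SOA.L2Structure.{u}) (hM : M.IsModelRCA0) :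
    List.TFAE [M.IsModelACA0, M.SatGS, M.SatWGS] := by
  have := Fact.mk hM
  tfae_have 1 → 2 := fun h => by
    have := Fact.mk h
    exact SOA.L2Structure.satGS_of_isModelACA0 M
  tfae_have 2 → 3 := fun h => h.satWGS
  tfae_have 3 → 1 := fun h => SOA.L2Structure.isModelACA0_of_proj_mem fun _ hA => h.proj_mem hA
  tfae_finish
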